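/- Let $D>3$. A fiducial state of physical dimension $2$ and bond dimension $D$ is a tensor $A=(A^0,A^1)\in(\mathbb C^{D\times D})^2\cong\mathbb C^2\otimes\mathbb C^D\otimes\mathbb C^D$, $|A\rangle=\sum_{i,\alpha,\beta}A^i_{\alpha\beta}|i\rangle|\alpha\rangle|\beta\rangle$; "almost every" and "measure zero" refer to Lebesgue measure on this space. For $x\in\mathbb C^D$ let $|A_x\rangle$ be the fiducial state of the diagonal pencil with $A_x^0=\mathbb 1$, $A_x^1=\operatorname{diag}(x_1,\dots,x_D)$. Say that $x$ admits only trivial Möbius permutations if every $g=\begin{pmatrix}\alpha&\beta\\\gamma&\delta\end{pmatrix}\in GL(2,\mathbb C)$ for which there is a permutation $\sigma$ with $\gamma x_i+\delta\neq0$ and $\frac{\alpha x_i+\beta}{\gamma x_i+\delta}=x_{\sigma(i)}$ for all $i$ is a multiple of $\mathbb 1$. The translationally invariant MPS generated by $A$ on $N$ sites is $|\Psi_N(A)\rangle=\sum_{i_0,\dots,i_{N-1}}\operatorname{tr}(A^{i_0}\cdots A^{i_{N-1}})|i_0\cdots i_{N-1}\rangle$. The tensor $A$ is injective at length $L$ if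 the linear map $X\mapsto\sum_{j_1,\dots,j_L}\operatorname{tr}(XA^{j_1}\cdots A^{j_L})|j_1\cdots j_L\rangle$ is injective, and normal if this holds for some $L$. Write $\mathcal S_{\Psi}$ for the group of operators $S_0\otimes\cdots\otimes S_{N-1}$ with $S_k\in GL(2,\mathbb C)$ that fix $\Psi$. Then: 1. If $D>4$, almost every $x\in\mathbb C^D$ admits only trivial Möbius permutations. 2. Almost every fiducial state is of the form $A=(\mathbb 1\otimes b\otimes c)A_x$ with $b,c\in GL(D,\mathbb C)$ and pairwise distinct $x_1,\dots,x_D$, where, if $D>4$, $x$ admits only trivial Möbius permutations. 3. Let $x\in\mathbb C^D$ admit only trivial Möbius permutations, and let $A=(a\otimes b\otimes c)A_x$ with $a\in GL(2,\mathbb C)$ and $b,c\in GL(D,\mathbb C)$. Then the $g\in GL(2,\mathbb C)$ for which $(g\otimes u\otimes v^T)A=A$ for some $u,v\in GL(D,\mathbb C)$ are exactly the nonzero multiples of $\mathbb 1$; and if $A$ is injective at length $L$, then $\mathcal S_{\Psi_N(A)}=\{\mathbb 1\}$ for all $N\ge 2L+1$. 4. Almost every fiducial state is normal, and the set of fiducial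 states $A$ that are injective at some length $L$ and satisfy $\mathcal S_{\Psi_N(A)}\neq\{\mathbb 1\}$ for some $N\ge 2L+1$ has measure zero. That is, for every $D>3$ the matrix product states with nontrivial local symmetries are of measure zero. -/

import Mathlib

open MeasureTheory
open scoped Matrix

namespace TIMPS

/-- Fiducial tripartite states `|A⟩ = ∑ A i α β |i⟩ ⊗ |α⟩ ⊗ |β⟩` with physical dimension `d` and
bond dimension `D`, given by their coefficients. The space carries Lebesgue measure. -/
abbrev Fiducial (d D : ℕ) : Type := Fin d → Fin D → Fin D → ℂ

/-- The matrix `A^i` with entries `A i α β`. -/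
def slice {d D : ℕ} (A : Fiducial d D) (i : Fin d) : Matrix (Fin D) (Fin D) ℂ :=
  Matrix.of (A i)

/-- The action of `g ⊗ x ⊗ z` on fiducial states. -/
def fiducialAct {d D : ℕ} (g : Matrix (Fin d) (Fin d) ℂ) (x z : Matrix (Fin D) (Fin D) ℂ)
    (A : Fiducial d D) : Fiducial d D :=
  fun i α β => ∑ j, ∑ α', ∑ β', g i j * x α α' * z β β' * A j α' β'

/-- `B` lies in the SLOCC class of `A`: `B = (a ⊗ b ⊗ c) A` with invertible `a, b, c`. -/
def SLOCCClass {d D : ℕ} (A : Fiducial d D) : Set (Fiducial d D) :=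
  {B | ∃ (a : GL (Fin d) ℂ) (b c : GL (Fin D) ℂ), B = fiducialAct a.1 b.1 c.1 A}

/-- The operators `g` that occur in a local symmetry `g ⊗ x ⊗ yᵀ` of the fiducial state. -/
def qubitSymmetries {d D : ℕ} (A : Fiducial d D) : Set (GL (Fin d) ℂ) :=
  {g | ∃ x y : GL (Fin D) ℂ, fiducialAct g.1 x.1 y.1ᵀ A = A}

/-- The nonzero multiples of the identity. -/
def trivialOperators (d : ℕ) : Set (GL (Fin d) ℂ) :=
  {g | ∃ c : ℂ, g.1 = c • (1 : Matrix (Fin d) (Fin d) ℂ)}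

/-- The fiducial state `|0⟩|Φ⟩ + |1⟩(diag(x) ⊗ 1)|Φ⟩`, with `|Φ⟩ = ∑ |α⟩|α⟩`, of the diagonal
matrix pencil with eigenvalues `x`. -/
def diagonalFiducial {D : ℕ} (x : Fin D → ℂ) : Fiducial 2 D :=
  ![(1 : Matrix (Fin D) (Fin D) ℂ), Matrix.diagonal x]

/-- The Möbius transformation of `g` is defined (and finite) on the eigenvalues `x` and permutes
them, respecting multiplicities. -/
def MoebiusPermutes {D : ℕ} (g : GL (Fin 2) ℂ) (x : Fin D → ℂ) : Prop :=
  ∃ σ : Equiv.Perm (Fin D), ∀ i, g.1 1 0 * x i + g.1 1 1 ≠ 0 ∧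
    (g.1 0 0 * x i + g.1 0 1) / (g.1 1 0 * x i + g.1 1 1) = x (σ i)

/-- Only the identity Möbius transformation permutes the eigenvalues `x`. -/
def OnlyTrivialMoebius {D : ℕ} (x : Fin D → ℂ) : Prop :=
  ∀ g : GL (Fin 2) ℂ, MoebiusPermutes g x → g ∈ trivialOperators 2

/-- The product `A^{w 0} A^{w 1} ⋯ A^{w (N-1)}`. -/
def wordProduct {d D N : ℕ} (A : Fiducial d D) (w : Fin N → Fin d) :
    Matrix (Fin D) (Fin D) ℂ :=
  (List.ofFn fun k => slice A (w k)).prod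

/-- The coefficients of the `N`-site translationally invariant matrix product state generated
by `A`. -/
def mps {d D : ℕ} (A : Fiducial d D) (N : ℕ) : (Fin N → Fin d) → ℂ :=
  fun w => (wordProduct A w).trace

/-- The contraction of `L` consecutive tensors is injective. -/
def InjectiveAtLength {d D : ℕ} (A : Fiducial d D) (L : ℕ) : Prop :=
  Function.Injective fun (X : Matrix (Fin D) (Fin D) ℂ) (w : Fin L → Fin d) =>
    (X * wordProduct A w).trace

/-- Normality of the tensor `A`. -/
def IsNormalTensor {d D : ℕ} (A : Fiducial d D) : Prop :=
  ∃ L, InjectiveAtLength A L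

/-- The operator `S 0 ⊗ S 1 ⊗ ⋯ ⊗ S (N-1)` in the computational basis. -/
def productOperator {d N : ℕ} (S : Fin N → Matrix (Fin d) (Fin d) ℂ) :
    Matrix (Fin N → Fin d) (Fin N → Fin d) ℂ :=
  Matrix.of fun s t => ∏ k, S k (s k) (t k)

/-- The group of invertible local symmetries of an `N`-partite state, as a set of operators. -/
def localSymmetries {d N : ℕ} (ψ : (Fin N → Fin d) → ℂ) :
    Set (Matrix (Fin N → Fin d) (Fin N → Fin d) ℂ) :=
  {T | ∃ S : Fin N → GL (Fin d) ℂ, T = productOperator (fun k => (S k).1) ∧ T *ᵥ ψ = ψ}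

end TIMPS

namespace TIMPS


/-! ### Zero sets of holomorphic functions are null -/

/-- An entire function that does not vanish at the origin vanishes almost nowhere on the real
line. -/
theorem ae_real_ne_zero {g : ℂ → ℂ} (hg : Differentiable ℂ g) (h0 : g 0 ≠ 0) :
    ∀ᵐ t : ℝ, g t ≠ 0 := by
  have han : AnalyticOnNhd ℂ g Set.univ := fun z _ => hg.analyticAt z
  have hev : ∀ z : ℂ, ∀ᶠ s in nhdsWithin z {z}ᶜ, g s ≠ 0 := by
    rcases han.eqOn_zero_or_eventually_ne_zero_of_preconnected isPreconnected_univ with h | h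
    · exact absurd (h (Set.mem_univ 0)) h0
    · intro z
      have := h
      rw [Filter.codiscreteWithin] at this
      simp only [Filter.eventually_iSup] at this
      have := this z (Set.mem_univ z)
      simpa [Set.compl_eq_univ_sdiff] using this
  rw [ae_iff]
  refine measure_null_of_locally_null _ fun t _ => ⟨{t}, ?_, by simp⟩
  have h1 := hev (t : ℂ)
  rw [eventually_nhdsWithin_iff] at h1
  have h2 := (Complex.continuous_ofReal.tendsto t).eventually h1
  rw [mem_nhdsWithin_iff_eventually]
  filter_upwards [h2] with s hs hsz
  by_contra hne
  refine hs ?_ (by simpa using hsz)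
  simpa using hne

/-- A holomorphic function on a finite-dimensional space vanishes identically or almost nowhere. -/
theorem ae_ne_zero_of_differentiable {E : Type*} [NormedAddCommGroup E] [NormedSpace ℂ E]
    [FiniteDimensional ℂ E] [MeasurableSpace E] [BorelSpace E] (μ : Measure E)
    [μ.IsAddHaarMeasure] {f : E → ℂ} (hf : Differentiable ℂ f) (p : E) (hp : f p ≠ 0) :
    ∀ᵐ x ∂μ, f x ≠ 0 := by
  have : FiniteDimensional ℝ E := FiniteDimensional.complexToReal E
  have : SecondCountableTopology E := secondCountable_of_proper
  have hc : Continuous fun z : E × ℝ => f (p + z.2 • z.1) := by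
    have := hf.continuous
    fun_prop
  have hm : MeasurableSet {z : E × ℝ | f (p + z.2 • z.1) ≠ 0} :=
    (isOpen_ne_fun hc continuous_const).measurableSet
  -- Every real line through `p` meets the zero set in a null set. Exchanging the quantifiers by
  -- Fubini gives one `t ≠ 0` that works for almost all `x`, and the affine map `x ↦ p + t • x`
  -- preserves null sets.
  have h1 : ∀ᵐ x ∂μ, ∀ᵐ t : ℝ, f (p + t • x) ≠ 0 := by
    refine Filter.Eventually.of_forall fun x => ?_
    have := ae_real_ne_zero (g := fun z : ℂ => f (p + z • x)) (by fun_prop) (by simpa using hp)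
    simpa using this
  rw [Measure.ae_ae_comm hm] at h1
  obtain ⟨t, ht, ht0⟩ := (h1.and (Measure.ae_ne volume (0 : ℝ))).exists
  rw [ae_iff] at ht ⊢
  have h2 : {x | ¬ f (p + t • x) ≠ 0} = (fun x => t • x) ⁻¹' ((fun x => p + x) ⁻¹' {x | ¬ f x ≠ 0}) :=
    rfl
  rw [h2, Measure.addHaar_preimage_smul _ ht0, measure_preimage_add] at ht
  simpa [ht0] using ht


/-! ### Möbius permutations and cross ratios -/

theorem exists_perm_of_card_fiber_eq {ι κ : Type*} [Fintype ι] [DecidableEq κ] (x y : ι → κ)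
    (h : ∀ l, Fintype.card {i // x i = l} = Fintype.card {i // y i = l}) :
    ∃ σ : Equiv.Perm ι, ∀ i, y i = x (σ i) := by
  have e : ∀ l, {i // y i = l} ≃ {i // x i = l} := fun l =>
    (Fintype.card_eq.1 (h l).symm).some
  refine ⟨(Equiv.sigmaFiberEquiv y).symm.trans
    ((Equiv.sigmaCongrRight e).trans (Equiv.sigmaFiberEquiv x)), fun i => ?_⟩
  exact ((e (y i)) ⟨i, rfl⟩).2.symm

/-- A Möbius transformation with three fixed points is trivial. -/
theorem mem_trivialOperators_of_fixed {g : GL (Fin 2) ℂ} {u v w : ℂ} (huv : u ≠ v) (huw : u ≠ w)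
    (hvw : v ≠ w)
    (h : ∀ z ∈ ({u, v, w} : Set ℂ), g.1 0 0 * z + g.1 0 1 = z * (g.1 1 0 * z + g.1 1 1)) :
    g ∈ trivialOperators 2 := by
  have hu := h u (by simp)
  have hv := h v (by simp)
  have hw := h w (by simp)
  have e1 : g.1 0 0 = g.1 1 0 * (u + v) + g.1 1 1 :=
    mul_left_cancel₀ (sub_ne_zero.2 huv) (by linear_combination hu - hv)
  have e2 : g.1 0 0 = g.1 1 0 * (u + w) + g.1 1 1 :=
    mul_left_cancel₀ (sub_ne_zero.2 huw) (by linear_combination hu - hw)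
  have e3 : g.1 1 0 = 0 :=
    mul_left_cancel₀ (sub_ne_zero.2 hvw) (by linear_combination e2 - e1)
  have e4 : g.1 0 1 = 0 := by
    rw [e3] at e1 hu
    linear_combination hu - u * e1
  refine ⟨g.1 1 1, ?_⟩
  rw [e3] at e1
  ext i j
  fin_cases i <;> fin_cases j <;> simp [e3, e4, e1]

theorem exists_three_ne {D : ℕ} (hD : 2 < D) : ∃ i j k : Fin D, i ≠ j ∧ i ≠ k ∧ j ≠ k := by
  rw [← Fintype.two_lt_card_iff]
  simpa using hD

theorem mem_trivialOperators_of_fixes {D : ℕ} (hD : 2 < D) {g : GL (Fin 2) ℂ} {x : Fin D → ℂ}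
    (hx : Function.Injective x)
    (h : ∀ i, g.1 0 0 * x i + g.1 0 1 = x i * (g.1 1 0 * x i + g.1 1 1)) :
    g ∈ trivialOperators 2 := by
  obtain ⟨i, j, k, hij, hik, hjk⟩ := exists_three_ne hD
  refine mem_trivialOperators_of_fixed (hx.ne hij) (hx.ne hik) (hx.ne hjk) ?_
  rintro z (rfl | rfl | rfl) <;> exact h _

/-- The difference of the cross ratios of `x` on the quadruples `i j k l` and
`σ i, σ j, σ k, σ l`, with denominators cleared. -/
def crossDifference {D : ℕ} (σ : Equiv.Perm (Fin D)) (i j k l : Fin D) (x : Fin D → ℂ) : ℂ :=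
  (x i - x j) * (x k - x l) * ((x (σ i) - x (σ l)) * (x (σ k) - x (σ j))) -
    (x i - x l) * (x k - x j) * ((x (σ i) - x (σ j)) * (x (σ k) - x (σ l)))

/-- A Möbius map multiplies each difference `x a - x b` by its determinant over the denominators at
`a` and `b`. Both products contain each of the four indices equally often, so these factors agree.
-/
theorem crossDifference_eq_zero {D : ℕ} {σ : Equiv.Perm (Fin D)} {x : Fin D → ℂ}
    {α β γ δ : ℂ} (h : ∀ i, γ * x i + δ ≠ 0 ∧ (α * x i + β) / (γ * x i + δ) = x (σ i))
    (i j k l : Fin D) : crossDifference σ i j k l x = 0 := by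
  have e : ∀ a b, (x (σ a) - x (σ b)) * ((γ * x a + δ) * (γ * x b + δ)) =
      (α * δ - β * γ) * (x a - x b) := by
    intro a b
    have ha := (h a).1
    have hb := (h b).1
    rw [← (h a).2, ← (h b).2, div_sub_div _ _ ha hb, div_mul_cancel₀ _ (mul_ne_zero ha hb)]
    ring
  have hq : (γ * x i + δ) * (γ * x l + δ) * ((γ * x k + δ) * (γ * x j + δ)) ≠ 0 :=
    mul_ne_zero (mul_ne_zero (h i).1 (h l).1) (mul_ne_zero (h k).1 (h j).1)
  refine mul_right_cancel₀ hq ?_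
  rw [crossDifference, zero_mul, sub_mul]
  have e1 := e i l
  have e2 := e k j
  have e3 := e i j
  have e4 := e k l
  calc _ = (x i - x j) * (x k - x l) *
        (((x (σ i) - x (σ l)) * ((γ * x i + δ) * (γ * x l + δ))) *
          ((x (σ k) - x (σ j)) * ((γ * x k + δ) * (γ * x j + δ)))) -
        (x i - x l) * (x k - x j) *
        (((x (σ i) - x (σ j)) * ((γ * x i + δ) * (γ * x j + δ))) *
          ((x (σ k) - x (σ l)) * ((γ * x k + δ) * (γ * x l + δ)))) := by ring
    _ = 0 := by rw [e1, e2, e3, e4]; ring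

/-- With five points, three indices `j, k, l` remain outside `{i, σ i}`. Setting the value at `σ i`
equal to that at `σ l` kills the first product and leaves every factor of the second nonzero. -/
theorem exists_crossDifference_ne_zero {D : ℕ} (hD : 4 < D) {σ : Equiv.Perm (Fin D)}
    (hσ : σ ≠ 1) : ∃ i j k l, ∃ x : Fin D → ℂ, crossDifference σ i j k l x ≠ 0 := by
  obtain ⟨i, hi⟩ : ∃ i, σ i ≠ i := by
    by_contra! h
    exact hσ (Equiv.ext h)
  have hcard : 2 < (({i, σ i} : Finset (Fin D))ᶜ).card := by
    rw [Finset.card_compl, Fintype.card_fin, Finset.card_pair hi.symm]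
    omega
  obtain ⟨j, hj, k, hk, l, hl, hjk, hjl, hkl⟩ := Finset.two_lt_card.1 hcard
  simp only [Finset.mem_compl, Finset.mem_insert, Finset.mem_singleton, not_or] at hj hk hl
  let z : Fin D → ℂ := fun m => (m : ℕ)
  have hz : Function.Injective z := fun a b hab => Fin.ext (Nat.cast_injective hab)
  refine ⟨i, j, k, l, Function.update z (σ i) (z (σ l)), ?_⟩
  have hσij : σ j ≠ σ i := fun h => hj.1 (σ.injective h)
  have hσik : σ k ≠ σ i := fun h => hk.1 (σ.injective h)
  have hσil : σ l ≠ σ i := fun h => hl.1 (σ.injective h)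
  simp only [crossDifference, Function.update_self, Function.update_of_ne hi.symm,
    Function.update_of_ne hj.2, Function.update_of_ne hk.2, Function.update_of_ne hl.2,
    Function.update_of_ne hσij, Function.update_of_ne hσik, Function.update_of_ne hσil,
    sub_self, zero_mul, mul_zero, zero_sub, neg_ne_zero]
  refine mul_ne_zero (mul_ne_zero ?_ ?_) (mul_ne_zero ?_ ?_) <;> refine sub_ne_zero.2 (hz.ne ?_)
  · exact (Ne.symm hl.1)
  · exact hjk.symm
  · exact fun h => hjl (σ.injective h).symm
  · exact fun h => hkl (σ.injective h)

section Generic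

variable {E : Type*} [NormedAddCommGroup E] [NormedSpace ℂ E] [FiniteDimensional ℂ E]
  [MeasurableSpace E] [BorelSpace E] (μ : Measure E) [μ.IsAddHaarMeasure]

theorem ae_injective {D : ℕ} {X : E → Fin D → ℂ} (hX : Differentiable ℂ X)
    (hs : Function.Surjective X) : ∀ᵐ e ∂μ, Function.Injective (X e) := by
  have h : ∀ i j : Fin D, ∀ᵐ e ∂μ, i ≠ j → X e i ≠ X e j := by
    intro i j
    by_cases hij : i = j
    · simp [hij]
    obtain ⟨p, hp⟩ := hs (fun m => ((m : ℕ) : ℂ))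
    have := ae_ne_zero_of_differentiable μ (f := fun e => X e i - X e j) (by fun_prop) p (by
      rw [hp, sub_ne_zero]
      exact fun h => hij (Fin.ext (Nat.cast_injective h)))
    filter_upwards [this] with e he _
    exact sub_ne_zero.1 he
  have h' := ae_all_iff.2 fun i => ae_all_iff.2 (h i)
  filter_upwards [h'] with e he i j hij
  by_contra hne
  exact he i j hne hij

/-- There are only finitely many permutations, and surjectivity of `X` supplies the point at which a
given `crossDifference` is nonzero. Allowing a general `X` covers both `ℂ^D` itself and eigenvalues
read off from a tensor. -/
theorem ae_onlyTrivialMoebius {D : ℕ} (hD : 4 < D) {X : E → Fin D → ℂ} (hX : Differentiable ℂ X)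
    (hs : Function.Surjective X) : ∀ᵐ e ∂μ, OnlyTrivialMoebius (X e) := by
  have h : ∀ σ : Equiv.Perm (Fin D), ∀ᵐ e ∂μ, σ ≠ 1 →
      ∃ i j k l, crossDifference σ i j k l (X e) ≠ 0 := by
    intro σ
    by_cases hσ : σ = 1
    · simp [hσ]
    obtain ⟨i, j, k, l, x, hx⟩ := exists_crossDifference_ne_zero hD hσ
    obtain ⟨p, rfl⟩ := hs x
    have := ae_ne_zero_of_differentiable μ (f := fun e => crossDifference σ i j k l (X e))
      (by unfold crossDifference; fun_prop) p hx
    filter_upwards [this] with e he _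
    exact ⟨i, j, k, l, he⟩
  rw [← ae_all_iff] at h
  filter_upwards [h, ae_injective μ hX hs] with e he hinj
  rintro g ⟨σ, hσ⟩
  by_cases h1 : σ = 1
  · refine mem_trivialOperators_of_fixes (by omega) hinj fun i => ?_
    have := (hσ i).2
    rw [div_eq_iff (hσ i).1] at this
    simpa [h1] using this
  · obtain ⟨i, j, k, l, hne⟩ := he σ h1
    exact absurd (crossDifference_eq_zero hσ i j k l) hne

end Generic


/-! ### Ranks of diagonal pencils -/

section Rank

variable {D : ℕ}

/-- The rank of right multiplication by `Y`. -/
noncomputable def mulRank (Y : Matrix (Fin D) (Fin D) ℂ) : ℕ :=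
  Module.finrank ℂ (LinearMap.mulRight ℂ Y).range

theorem finrank_range_comp_of_injective {V W U : Type*} [AddCommGroup V] [Module ℂ V]
    [AddCommGroup W] [Module ℂ W] [AddCommGroup U] [Module ℂ U] (f : V →ₗ[ℂ] W) (j : W →ₗ[ℂ] U)
    (hj : Function.Injective j) :
    Module.finrank ℂ (j ∘ₗ f).range = Module.finrank ℂ f.range := by
  rw [LinearMap.range_comp]
  exact (LinearEquiv.finrank_eq (Submodule.equivMapOfInjective j hj f.range)).symm

theorem mulRank_mul_mul (b c : GL (Fin D) ℂ) (Y : Matrix (Fin D) (Fin D) ℂ) :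
    mulRank (b.1 * Y * c.1) = mulRank Y := by
  have h : LinearMap.mulRight ℂ (b.1 * Y * c.1) =
      LinearMap.mulRight ℂ c.1 ∘ₗ (LinearMap.mulRight ℂ Y ∘ₗ LinearMap.mulRight ℂ b.1) := by
    ext1 R
    simp [mul_assoc]
  have hb : (LinearMap.mulRight ℂ b.1).range = ⊤ := by
    rw [LinearMap.range_eq_top]
    exact fun R => ⟨R * b⁻¹.1, by simp [mul_assoc]⟩
  have hc : Function.Injective (LinearMap.mulRight ℂ c.1) := by
    intro R R' hR
    simpa using congrArg (· * c⁻¹.1) hR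
  rw [mulRank, h, finrank_range_comp_of_injective _ _ hc, LinearMap.range_comp_of_range_eq_top _ hb,
    mulRank]

/-- On vectorized matrices, right multiplication by `diag y` is a diagonal operator in which each `y
i` occurs `D` times. -/
theorem mulRank_diagonal (y : Fin D → ℂ) :
    mulRank (Matrix.diagonal y) = D * Fintype.card {i // y i ≠ 0} := by
  let e : Matrix (Fin D) (Fin D) ℂ ≃ₗ[ℂ] (Fin D × Fin D → ℂ) :=
    (LinearEquiv.curry ℂ ℂ (Fin D) (Fin D)).symm
  have h : e.toLinearMap ∘ₗ LinearMap.mulRight ℂ (Matrix.diagonal y) =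
      (Matrix.diagonal fun z : Fin D × Fin D => y z.2).mulVecLin ∘ₗ e.toLinearMap := by
    ext1 R
    ext z
    rw [LinearMap.comp_apply, LinearMap.comp_apply, Matrix.mulVecLin_apply, Matrix.mulVec_diagonal,
      mul_comm]
    exact Matrix.mul_diagonal y R z.1 z.2
  rw [mulRank, ← finrank_range_comp_of_injective _ _ e.injective, h,
    LinearMap.range_comp_of_range_eq_top _ e.range]
  have h2 := Matrix.rank_diagonal (fun z : Fin D × Fin D => y z.2)
  rw [Matrix.rank] at h2
  rw [h2]
  have : {z : Fin D × Fin D // y z.2 ≠ 0} ≃ Fin D × {i // y i ≠ 0} :=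
    ⟨fun z => (z.1.1, ⟨z.1.2, z.2⟩), fun z => ⟨(z.1, z.2.1), z.2.2⟩, fun _ => rfl, fun _ => rfl⟩
  rw [Fintype.card_congr this, Fintype.card_prod, Fintype.card_fin]

theorem card_ne_zero_eq_of_mulRank_eq (hD : 0 < D) (b c : GL (Fin D) ℂ) {y z : Fin D → ℂ}
    (h : mulRank (b.1 * Matrix.diagonal y * c.1) = mulRank (b.1 * Matrix.diagonal z * c.1)) :
    Fintype.card {i // y i = 0} = Fintype.card {i // z i = 0} := by
  rw [mulRank_mul_mul, mulRank_mul_mul, mulRank_diagonal, mulRank_diagonal] at h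
  have h1 := Nat.eq_of_mul_eq_mul_left hD h
  have h2 := Fintype.card_subtype_compl (fun i => y i = 0)
  have h3 := Fintype.card_subtype_compl (fun i => z i = 0)
  have h4 := Fintype.card_subtype_le (fun i => y i = 0)
  have h5 := Fintype.card_subtype_le (fun i => z i = 0)
  simp only [ne_eq] at h1
  omega

/-- If the diagonal pencils with coefficients `1, x` and `h₀₀ + h₀₁ x, h₁₀ + h₁₁ x` have the same
ranks, then the Möbius transformation of `h` permutes `x`. -/
theorem exists_perm_of_mulRank_eq (hD : 0 < D) (b c : GL (Fin D) ℂ) (x : Fin D → ℂ)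
    (h : Matrix (Fin 2) (Fin 2) ℂ)
    (hr : ∀ κ : Fin 2 → ℂ, mulRank (b.1 * Matrix.diagonal (fun i => κ 0 + κ 1 * x i) * c.1) =
      mulRank (b.1 * Matrix.diagonal (fun i => κ 0 * (h 0 0 + h 0 1 * x i) +
        κ 1 * (h 1 0 + h 1 1 * x i)) * c.1)) :
    ∃ σ : Equiv.Perm (Fin D), ∀ i, h 0 0 + h 0 1 * x i ≠ 0 ∧
      h 1 0 + h 1 1 * x i = x (σ i) * (h 0 0 + h 0 1 * x i) := by
  have hc := fun κ => card_ne_zero_eq_of_mulRank_eq hD b c (hr κ)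
  have h0 : ∀ i, h 0 0 + h 0 1 * x i ≠ 0 := by
    -- At `κ = (1, 0)` the first pencil is the identity and has no zero entries, so the denominators
    -- never vanish.
    have := hc ![1, 0]
    simp only [Matrix.cons_val_zero, Matrix.cons_val_one, zero_mul, add_zero, one_mul,
      one_ne_zero] at this
    intro i hi
    have h1 : 0 < Fintype.card {i // h 0 0 + h 0 1 * x i = 0} :=
      Fintype.card_pos_iff.2 ⟨⟨i, hi⟩⟩
    rw [← this] at h1
    simp at h1
  obtain ⟨σ, hσ⟩ := exists_perm_of_card_fiber_eq x
    (fun i => (h 1 0 + h 1 1 * x i) / (h 0 0 + h 0 1 * x i)) (by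
      intro l
      -- The zeros of `x - l` count the multiplicity of `l` among the eigenvalues, on each side.
      have := hc ![-l, 1]
      simp only [Matrix.cons_val_zero, Matrix.cons_val_one, one_mul] at this
      convert this using 3 <;> funext i <;> apply propext
      · rw [neg_add_eq_zero, eq_comm]
      · rw [div_eq_iff (h0 i), neg_mul, neg_add_eq_zero, eq_comm])
  exact ⟨σ, fun i => ⟨h0 i, (div_eq_iff (h0 i)).1 (hσ i)⟩⟩

end Rank

/-! ### Qubit symmetries of tensors in the class of a diagonal pencil -/

section Pencil

variable {D : ℕ}

theorem slice_fiducialAct {d : ℕ} (g : Matrix (Fin d) (Fin d) ℂ) (u v : Matrix (Fin D) (Fin D) ℂ)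
    (A : Fiducial d D) (i : Fin d) :
    slice (fiducialAct g u v A) i = ∑ j, g i j • (u * slice A j * vᵀ) := by
  ext α β
  simp only [slice, fiducialAct, Matrix.of_apply, Matrix.sum_apply, Matrix.smul_apply,
    Matrix.mul_apply, Matrix.transpose_apply, smul_eq_mul, Finset.mul_sum, Finset.sum_mul]
  refine Finset.sum_congr rfl fun j _ => ?_
  rw [Finset.sum_comm]
  refine Finset.sum_congr rfl fun _ _ => Finset.sum_congr rfl fun _ _ => by ring

theorem slice_diagonalFiducial (x : Fin D → ℂ) (i : Fin 2) :
    slice (diagonalFiducial x) i = Matrix.diagonal fun α => x α ^ (i : ℕ) := by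
  fin_cases i
  · ext α β
    change (1 : Matrix (Fin D) (Fin D) ℂ) α β = _
    simp [Matrix.one_apply, Matrix.diagonal_apply]
  · ext α β
    change Matrix.diagonal x α β = _
    simp

theorem sum_smul_mul_diagonal (b c : Matrix (Fin D) (Fin D) ℂ) (x : Fin D → ℂ) (κ : Fin 2 → ℂ) :
    ∑ j, κ j • (b * slice (diagonalFiducial x) j * c) =
      b * Matrix.diagonal (fun i => κ 0 + κ 1 * x i) * c := by
  have : Matrix.diagonal (fun i => κ 0 + κ 1 * x i) =
      κ 0 • (1 : Matrix (Fin D) (Fin D) ℂ) + κ 1 • Matrix.diagonal x := by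
    ext i j
    by_cases hij : i = j <;> simp [hij]
  rw [this]
  simp [slice_diagonalFiducial, mul_add, add_mul]

/-- The transpose of an invertible matrix, as an invertible matrix. -/
noncomputable def transposeGL (c : GL (Fin D) ℂ) : GL (Fin D) ℂ :=
  ⟨c.1ᵀ, c⁻¹.1ᵀ, by rw [← Matrix.transpose_mul]; simp, by rw [← Matrix.transpose_mul]; simp⟩

theorem sum_smul_slice (a : GL (Fin 2) ℂ) (b c : GL (Fin D) ℂ) (x : Fin D → ℂ)
    (κ : Fin 2 → ℂ) :
    ∑ i, κ i • slice (fiducialAct a.1 b.1 c.1 (diagonalFiducial x)) i =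
      b.1 * Matrix.diagonal (fun i => (κ ᵥ* a.1) 0 + (κ ᵥ* a.1) 1 * x i) * c.1ᵀ := by
  rw [← sum_smul_mul_diagonal]
  simp only [slice_fiducialAct, Finset.smul_sum, smul_smul]
  rw [Finset.sum_comm]
  simp only [← Finset.sum_smul]
  rfl

theorem exists_perm_of_pencil_mulRank_eq (hD : 0 < D) (a g : GL (Fin 2) ℂ) (b c : GL (Fin D) ℂ)
    (x : Fin D → ℂ) {A : Fiducial 2 D} (hA : A = fiducialAct a.1 b.1 c.1 (diagonalFiducial x))
    (h : ∀ κ : Fin 2 → ℂ, mulRank (∑ i, κ i • slice A i) =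
      mulRank (∑ i, κ i • ∑ j, g.1 i j • slice A j)) :
    ∃ σ : Equiv.Perm (Fin D), ∀ i,
      (a⁻¹ * g * a).1 0 0 + (a⁻¹ * g * a).1 0 1 * x i ≠ 0 ∧
      (a⁻¹ * g * a).1 1 0 + (a⁻¹ * g * a).1 1 1 * x i =
        x (σ i) * ((a⁻¹ * g * a).1 0 0 + (a⁻¹ * g * a).1 0 1 * x i) := by
  refine exists_perm_of_mulRank_eq hD b (transposeGL c) x _ fun κ => ?_
  have h1 := h (κ ᵥ* a⁻¹.1)
  have h2 : ∑ i, (κ ᵥ* a⁻¹.1) i • ∑ j, g.1 i j • slice A j =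
      ∑ j, (κ ᵥ* (a⁻¹.1 * g.1)) j • slice A j := by
    rw [← Matrix.vecMul_vecMul]
    simp only [Finset.smul_sum, smul_smul]
    rw [Finset.sum_comm]
    simp only [← Finset.sum_smul]
    rfl
  rw [h2, hA, sum_smul_slice, sum_smul_slice] at h1
  have e1 : κ ᵥ* a⁻¹.1 ᵥ* a.1 = κ := by
    rw [Matrix.vecMul_vecMul, ← Units.val_mul, inv_mul_cancel, Units.val_one, Matrix.vecMul_one]
  rw [e1, Matrix.vecMul_vecMul] at h1
  refine h1.trans (congrArg (fun y => mulRank (b.1 * Matrix.diagonal y * c.1ᵀ)) ?_)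
  ext i
  have e2 : (a⁻¹ * g * a).1 = a⁻¹.1 * g.1 * a.1 := rfl
  rw [e2]
  simp only [Matrix.vecMul, dotProduct, Fin.sum_univ_two]
  ring

/-- Reversing the order of the basis of `ℂ²`. -/
theorem exists_flip (h : GL (Fin 2) ℂ) : ∃ f : GL (Fin 2) ℂ,
    f.1 0 0 = h.1 1 1 ∧ f.1 0 1 = h.1 1 0 ∧ f.1 1 0 = h.1 0 1 ∧ f.1 1 1 = h.1 0 0 := by
  refine ⟨Matrix.GeneralLinearGroup.mkOfDetNeZero !![h.1 1 1, h.1 1 0; h.1 0 1, h.1 0 0] ?_,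
    rfl, rfl, rfl, rfl⟩
  have := (Matrix.isUnits_det_units h).ne_zero
  rw [Matrix.det_fin_two] at this
  rw [Matrix.det_fin_two_of]
  intro h0
  exact this (by rw [← h0]; ring)

theorem mem_trivialOperators_of_flip {h f : GL (Fin 2) ℂ} (h0 : f.1 0 0 = h.1 1 1)
    (h1 : f.1 0 1 = h.1 1 0) (h2 : f.1 1 0 = h.1 0 1) (h3 : f.1 1 1 = h.1 0 0)
    (hf : f ∈ trivialOperators 2) : h ∈ trivialOperators 2 := by
  obtain ⟨c, hc⟩ := hf
  refine ⟨c, ?_⟩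
  rw [hc] at h0 h1 h2 h3
  ext i j
  fin_cases i <;> fin_cases j
  · simpa using h3.symm
  · simpa using h2.symm
  · simpa using h1.symm
  · simpa using h0.symm

theorem mem_trivialOperators_of_conj {a g : GL (Fin 2) ℂ}
    (h : a⁻¹ * g * a ∈ trivialOperators 2) : g ∈ trivialOperators 2 := by
  obtain ⟨c, hc⟩ := h
  refine ⟨c, ?_⟩
  have h1 : g = a * (a⁻¹ * g * a) * a⁻¹ := by group
  rw [h1, Units.val_mul, Units.val_mul, hc]
  simp

theorem mem_trivialOperators_of_mulRank_eq (hD : 0 < D) {x : Fin D → ℂ}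
    (hx : OnlyTrivialMoebius x) {A : Fiducial 2 D} (hA : A ∈ SLOCCClass (diagonalFiducial x))
    (g : GL (Fin 2) ℂ) (h : ∀ κ : Fin 2 → ℂ, mulRank (∑ i, κ i • slice A i) =
      mulRank (∑ i, κ i • ∑ j, g.1 i j • slice A j)) : g ∈ trivialOperators 2 := by
  obtain ⟨a, b, c, hA⟩ := hA
  obtain ⟨σ, hσ⟩ := exists_perm_of_pencil_mulRank_eq hD a g b c x hA h
  -- The permutation comes from the action on `(1, x)`, whereas `MoebiusPermutes` uses the action on
  -- `(x, 1)`.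
  obtain ⟨f, h0, h1, h2, h3⟩ := exists_flip (a⁻¹ * g * a)
  refine mem_trivialOperators_of_conj (mem_trivialOperators_of_flip h0 h1 h2 h3
    (hx f ⟨σ, fun i => ?_⟩))
  rw [h0, h1, h2, h3]
  have e1 := (hσ i).1
  have e2 := (hσ i).2
  rw [add_comm] at e1
  refine ⟨e1, ?_⟩
  rw [div_eq_iff e1]
  linear_combination e2

/-- A symmetry makes the transformed pencil equivalent to the original through `u` and `v`, so all
ranks agree. Conversely, a scalar `c` is compensated by `u = c⁻¹`. -/
theorem qubitSymmetries_eq (hD : 0 < D) {x : Fin D → ℂ} (hx : OnlyTrivialMoebius x)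
    {A : Fiducial 2 D} (hA : A ∈ SLOCCClass (diagonalFiducial x)) :
    qubitSymmetries A = trivialOperators 2 := by
  ext g
  constructor
  · rintro ⟨u, v, huv⟩
    refine mem_trivialOperators_of_mulRank_eq hD hx hA g fun κ => ?_
    rw [← mulRank_mul_mul u v (∑ i, κ i • ∑ j, g.1 i j • slice A j)]
    congr 1
    conv_lhs => rw [← huv]
    simp only [slice_fiducialAct, Matrix.transpose_transpose, Finset.mul_sum, Finset.sum_mul,
      Finset.smul_sum, Matrix.mul_smul, Matrix.smul_mul]
  · rintro ⟨c, hc⟩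
    have hc0 : c ≠ 0 := by
      rintro rfl
      have := (Matrix.isUnits_det_units g).ne_zero
      rw [hc] at this
      simp at this
    refine ⟨Units.mk0 c⁻¹ (inv_ne_zero hc0) • 1, 1, ?_⟩
    have : ∀ i, slice (fiducialAct g.1 (Units.mk0 c⁻¹ (inv_ne_zero hc0) • (1 : GL (Fin D) ℂ)).1
        (1 : GL (Fin D) ℂ).1ᵀ A) i = slice A i := by
      intro i
      rw [slice_fiducialAct, hc]
      simp [Matrix.one_apply, Units.smul_def, smul_smul, hc0]
    funext i
    exact Matrix.of.injective (this i)

end Pencil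


/-! ### Injective blocks and the ranks determined by a state -/

section Blocks

variable {d D : ℕ}

/-- The product `B p w₀ * B (p + 1) w₁ * ⋯` over the word `w`. -/
def blockProduct (B : ℕ → Fin d → Matrix (Fin D) (Fin D) ℂ) :
    ℕ → List (Fin d) → Matrix (Fin D) (Fin D) ℂ
  | _, [] => 1
  | p, i :: w => B p i * blockProduct B (p + 1) w

/-- The tensor `A` with the operator `S p` applied to its physical index. -/
def dressed (S : ℕ → Matrix (Fin d) (Fin d) ℂ) (A : Fiducial d D) (p : ℕ) (i : Fin d) :
    Matrix (Fin D) (Fin D) ℂ :=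
  ∑ j, S p i j • slice A j

/-- The block of the `l` tensors of `B` starting at `p` is injective. -/
def Separates (B : ℕ → Fin d → Matrix (Fin D) (Fin D) ℂ) (p l : ℕ) : Prop :=
  ∀ X : Matrix (Fin D) (Fin D) ℂ,
    (∀ w : List (Fin d), w.length = l → (X * blockProduct B p w).trace = 0) → X = 0

/-- The families `A` and `B` generate the same states on `N` sites, from every starting site. -/
def SameState (A B : ℕ → Fin d → Matrix (Fin D) (Fin D) ℂ) (N : ℕ) : Prop :=
  ∀ p (w : List (Fin d)), w.length = N → (blockProduct A p w).trace = (blockProduct B p w).trace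

theorem blockProduct_append (B : ℕ → Fin d → Matrix (Fin D) (Fin D) ℂ) (p : ℕ)
    (w v : List (Fin d)) :
    blockProduct B p (w ++ v) = blockProduct B p w * blockProduct B (p + w.length) v := by
  induction w generalizing p with
  | nil => simp [blockProduct]
  | cons i w ih => simp [blockProduct, ih, mul_assoc, add_assoc, add_comm 1]

theorem blockProduct_const (A : Fin d → Matrix (Fin D) (Fin D) ℂ) (p : ℕ) (w : List (Fin d)) :
    blockProduct (fun _ => A) p w = (w.map A).prod := by
  induction w generalizing p with
  | nil => simp [blockProduct]
  | cons i w ih => simp [blockProduct, ih]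

theorem eq_zero_of_forall_trace_mul {X : Matrix (Fin D) (Fin D) ℂ} (h : ∀ Y, (X * Y).trace = 0) :
    X = 0 :=
  Matrix.ext_iff_trace_mul_right.2 fun Y => by simp [h Y]

theorem exists_eq_trace_mul (f : Matrix (Fin D) (Fin D) ℂ →ₗ[ℂ] ℂ) :
    ∃ X : Matrix (Fin D) (Fin D) ℂ, ∀ Y, f Y = (X * Y).trace := by
  refine ⟨Matrix.of fun j i => f (Matrix.single i j 1), fun Y => ?_⟩
  conv_lhs => rw [Matrix.matrix_eq_sum_single Y]
  have : ∀ i j, Matrix.single i j (Y i j) = Y i j • Matrix.single i j (1 : ℂ) := by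
    intro i j
    simp [Matrix.smul_single]
  simp only [this, map_sum, map_smul, Matrix.trace, Matrix.diag, Matrix.mul_apply, Matrix.of_apply,
    smul_eq_mul]
  rw [Finset.sum_comm]
  exact Finset.sum_congr rfl fun _ _ => Finset.sum_congr rfl fun _ _ => mul_comm _ _

/-- Linear combinations of the products over the words of length `l`. -/
noncomputable def blockComb (B : ℕ → Fin d → Matrix (Fin D) (Fin D) ℂ) (p l : ℕ) :
    ({w : List (Fin d) // w.length = l} →₀ ℂ) →ₗ[ℂ] Matrix (Fin D) (Fin D) ℂ :=
  Finsupp.linearCombination ℂ fun w => blockProduct B p w.1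

theorem blockComb_single (B : ℕ → Fin d → Matrix (Fin D) (Fin D) ℂ) (p l : ℕ)
    (w : {w : List (Fin d) // w.length = l}) :
    blockComb B p l (Finsupp.single w 1) = blockProduct B p w.1 := by
  simp [blockComb]

/-- Duality: a functional vanishing on all block products has the form `Y ↦ tr (X * Y)`, and
injectivity of the block gives `X = 0`. -/
theorem Separates.range_blockComb {B : ℕ → Fin d → Matrix (Fin D) (Fin D) ℂ} {p l : ℕ}
    (h : Separates B p l) : (blockComb B p l).range = ⊤ := by
  by_contra hne
  obtain ⟨f, hf, hle⟩ := Submodule.exists_le_ker_of_lt_top _ (lt_top_iff_ne_top.2 hne)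
  obtain ⟨X, hX⟩ := exists_eq_trace_mul f
  refine hf (LinearMap.ext fun Y => ?_)
  rw [hX, h X fun w hw => ?_]
  · simp
  · rw [← hX, ← blockComb_single B p l ⟨w, hw⟩]
    exact hle (LinearMap.mem_range_self _ _)

theorem Separates.surjective_blockComb {B : ℕ → Fin d → Matrix (Fin D) (Fin D) ℂ} {p l : ℕ}
    (h : Separates B p l) : Function.Surjective (blockComb B p l) :=
  LinearMap.range_eq_top.1 h.range_blockComb

/-- Peeling off the first site shows `X * B p i = 0` for all `i`; hence `X` annihilates every
nonempty word, in particular those of length `l > 0`. -/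
theorem separates_of_le {B : ℕ → Fin d → Matrix (Fin D) (Fin D) ℂ} {l : ℕ} (hl : 0 < l)
    (h : ∀ p, Separates B p l) {m : ℕ} (hm : l ≤ m) (p : ℕ) : Separates B p m := by
  induction m, hm using Nat.le_induction generalizing p with
  | base => exact h p
  | succ m hm ih =>
    intro X hX
    have h1 : ∀ i, X * B p i = 0 := fun i =>
      ih (p + 1) _ fun w hw => by
        rw [mul_assoc]
        exact hX (i :: w) (by simp [hw])
    refine h p X fun w hw => ?_
    cases w with
    | nil => simp at hw; omega
    | cons i w => simp [blockProduct, ← mul_assoc, h1]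

theorem separates_dressed {S : ℕ → GL (Fin d) ℂ} {A : Fiducial d D} {l : ℕ} {p : ℕ}
    (h : Separates (fun _ => slice A) p l) : Separates (dressed (fun k => (S k).1) A) p l := by
  -- The operators are inverted one site at a time, absorbing each processed site into `X`. The
  -- positions `p` and `q` are independent because the undressed product is the same at every site.
  have key : ∀ (l p q : ℕ) (X : Matrix (Fin D) (Fin D) ℂ),
      (∀ w : List (Fin d), w.length = l →
        (X * blockProduct (dressed (fun k => (S k).1) A) p w).trace = 0) →
      ∀ w : List (Fin d), w.length = l → (X * blockProduct (fun _ => slice A) q w).trace = 0 := by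
    intro l
    induction l with
    | zero =>
      intro p q X hX w hw
      have := hX w hw
      rw [List.length_eq_zero_iff] at hw
      subst hw
      exact this
    | succ l ih =>
      intro p q X hX w hw
      cases w with
      | nil => simp at hw
      | cons i w =>
        have hw' : w.length = l := by simpa using hw
        have h1 : ∀ j, (X * dressed (fun k => (S k).1) A p j *
            blockProduct (fun _ => slice A) (q + 1) w).trace = 0 := fun j =>
          ih (p + 1) (q + 1) _ (fun v hv => by
            rw [mul_assoc]
            exact hX (j :: v) (by simp [hv])) w hw'
        have h2 : slice A i = ∑ j, (S p)⁻¹.1 i j • dressed (fun k => (S k).1) A p j := by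
          have h3 : (S p)⁻¹.1 * (S p).1 = 1 := by simp
          simp only [dressed, Finset.smul_sum, smul_smul]
          rw [Finset.sum_comm]
          simp only [← Finset.sum_smul]
          have h4 : ∀ j, ∑ k, (S p)⁻¹.1 i k * (S p).1 k j = (1 : Matrix (Fin d) (Fin d) ℂ) i j := by
            intro j
            rw [← h3, Matrix.mul_apply]
          simp only [h4]
          simp [Matrix.one_apply]
        simp only [blockProduct]
        rw [← mul_assoc, h2, Finset.mul_sum, Finset.sum_mul, Matrix.trace_sum]
        exact Finset.sum_eq_zero fun j _ => by
          rw [Matrix.mul_smul, Matrix.smul_mul, Matrix.trace_smul, h1, smul_zero]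
  exact fun X hX => h X (key l p p X hX)

/-- The splitting of a state into one site, a block of length `l` and a block of length `m`, for
linear combinations of words. -/
theorem SameState.trace_eq {A B : ℕ → Fin d → Matrix (Fin D) (Fin D) ℂ} {l m : ℕ}
    (h : SameState A B (1 + l + m)) (p : ℕ) (i : Fin d)
    (c : {w : List (Fin d) // w.length = l} →₀ ℂ) (e : {w : List (Fin d) // w.length = m} →₀ ℂ) :
    (A p i * blockComb A (p + 1) l c * blockComb A (p + 1 + l) m e).trace =
      (B p i * blockComb B (p + 1) l c * blockComb B (p + 1 + l) m e).trace := by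
  have hw : ∀ (w v : List (Fin d)), w.length = l → v.length = m →
      (A p i * blockProduct A (p + 1) w * blockProduct A (p + 1 + l) v).trace =
      (B p i * blockProduct B (p + 1) w * blockProduct B (p + 1 + l) v).trace := by
    intro w v hw hv
    have := h p (i :: (w ++ v)) (by simp [hw, hv]; omega)
    simpa only [blockProduct, blockProduct_append, hw, mul_assoc] using this
  simp only [blockComb, Finsupp.linearCombination_apply, Finsupp.sum, Finset.mul_sum,
    Finset.sum_mul, Matrix.mul_smul, Matrix.smul_mul, Matrix.trace_sum, Matrix.trace_smul]
  refine Finset.sum_congr rfl fun v _ => ?_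
  simp only [fun w : {w : List (Fin d) // w.length = l} => hw w.1 v.1 w.2 v.2]

/-- The linear map `X ↦ (tr (X * blockProduct B p w))` over the words `w` of length `l`. -/
noncomputable def blockTrace (B : ℕ → Fin d → Matrix (Fin D) (Fin D) ℂ) (p l : ℕ) :
    Matrix (Fin D) (Fin D) ℂ →ₗ[ℂ] ({w : List (Fin d) // w.length = l} → ℂ) :=
  LinearMap.pi fun w => Matrix.traceLinearMap (Fin D) ℂ ℂ ∘ₗ
    LinearMap.mulRight ℂ (blockProduct B p w.1)

theorem blockTrace_apply (B : ℕ → Fin d → Matrix (Fin D) (Fin D) ℂ) (p l : ℕ)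
    (X : Matrix (Fin D) (Fin D) ℂ) (w : {w : List (Fin d) // w.length = l}) :
    blockTrace B p l X w = (X * blockProduct B p w.1).trace := rfl

theorem Separates.injective_blockTrace {B : ℕ → Fin d → Matrix (Fin D) (Fin D) ℂ} {p l : ℕ}
    (h : Separates B p l) : Function.Injective (blockTrace B p l) := by
  rw [← LinearMap.ker_eq_bot, LinearMap.ker_eq_bot']
  refine fun X hX => h X fun w hw => ?_
  rw [← blockTrace_apply B p l X ⟨w, hw⟩, hX, Pi.zero_apply]

/-- An injective map after and a surjective one before leave the rank of `R ↦ R * Y` unchanged. For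
`Y` a combination of the matrices at the site between the blocks, the composite is expressed through
coefficients of the state alone. -/
theorem mulRank_eq_finrank_range {B : ℕ → Fin d → Matrix (Fin D) (Fin D) ℂ} {p q l m : ℕ}
    (hl : Separates B p l) (hm : Separates B q m) (Y : Matrix (Fin D) (Fin D) ℂ) :
    mulRank Y = Module.finrank ℂ
      ((blockTrace B p l ∘ₗ LinearMap.mulRight ℂ Y) ∘ₗ blockComb B q m).range := by
  rw [LinearMap.range_comp_of_range_eq_top _ hm.range_blockComb,
    finrank_range_comp_of_injective _ _ hl.injective_blockTrace, mulRank]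

theorem SameState.mulRank_eq {A B : ℕ → Fin d → Matrix (Fin D) (Fin D) ℂ} {l m : ℕ}
    (h : SameState A B (1 + l + m)) (p : ℕ) (hA : ∀ q, Separates A q l) (hB : ∀ q, Separates B q l)
    (hA' : ∀ q, Separates A q m) (hB' : ∀ q, Separates B q m) (κ : Fin d → ℂ) :
    mulRank (∑ i, κ i • A p i) = mulRank (∑ i, κ i • B p i) := by
  rw [mulRank_eq_finrank_range (hA (p + 1)) (hA' (p + 1 + l)),
    mulRank_eq_finrank_range (hB (p + 1)) (hB' (p + 1 + l))]
  have key : (blockTrace A (p + 1) l ∘ₗ LinearMap.mulRight ℂ (∑ i, κ i • A p i)) ∘ₗ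
      blockComb A (p + 1 + l) m =
      (blockTrace B (p + 1) l ∘ₗ LinearMap.mulRight ℂ (∑ i, κ i • B p i)) ∘ₗ
      blockComb B (p + 1 + l) m := by
    refine LinearMap.ext fun e => funext fun w => ?_
    have := fun i => h.trace_eq p i (Finsupp.single w 1) e
    simp only [blockComb_single] at this
    simp only [LinearMap.comp_apply, blockTrace_apply, LinearMap.mulRight_apply]
    rw [mul_assoc, mul_assoc, Matrix.trace_mul_comm, Matrix.trace_mul_comm (blockComb B _ _ _)]
    simp only [Finset.sum_mul, Matrix.smul_mul, Matrix.trace_sum, Matrix.trace_smul, this]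
  rw [key]

end Blocks

/-! ### From local symmetries of the state to dressed tensors on the ring -/

section Chain

variable {d D : ℕ}

theorem blockProduct_ofFn (B : ℕ → Fin d → Matrix (Fin D) (Fin D) ℂ) (p : ℕ) {n : ℕ}
    (w : Fin n → Fin d) :
    blockProduct B p (List.ofFn w) = (List.ofFn fun k : Fin n => B (p + k) (w k)).prod := by
  induction n generalizing p with
  | zero => simp [blockProduct]
  | succ n ih =>
    simp only [List.ofFn_succ, blockProduct, ih, List.prod_cons]
    congr 2
    simp [add_assoc, add_comm 1]

theorem exists_ofFn_eq (w : List (Fin d)) {n : ℕ} (h : w.length = n) :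
    ∃ v : Fin n → Fin d, List.ofFn v = w := by
  subst h
  exact ⟨w.get, List.ofFn_get w⟩

theorem InjectiveAtLength.separates {A : Fiducial d D} {L : ℕ} (h : InjectiveAtLength A L) (p : ℕ) :
    Separates (fun _ => slice A) p L := by
  intro X hX
  apply h
  funext w
  have := hX (List.ofFn w) (by simp)
  rw [blockProduct_ofFn] at this
  simpa [wordProduct] using this

theorem InjectiveAtLength.pos {A : Fiducial d D} {L : ℕ} (h : InjectiveAtLength A L) (hD : 1 < D) :
    0 < L := by
  rcases Nat.eq_zero_or_pos L with rfl | hL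
  -- At length `0` the contraction sees only the trace, which kills an off-diagonal matrix unit.
  · have : Matrix.single (⟨0, by omega⟩ : Fin D) (⟨1, hD⟩ : Fin D) (1 : ℂ) = 0 := by
      apply h
      funext w
      simp [wordProduct]
    simpa using congrArg (fun M : Matrix (Fin D) (Fin D) ℂ => M ⟨0, by omega⟩ ⟨1, hD⟩) this
  · exact hL

theorem sum_prod_smul_ofFn {n : ℕ} (A : Fin d → Matrix (Fin D) (Fin D) ℂ)
    (M : Fin n → Fin d → ℂ) :
    ∑ t : Fin n → Fin d, (∏ k, M k (t k)) • (List.ofFn fun k => A (t k)).prod =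
      (List.ofFn fun k => ∑ j, M k j • A j).prod := by
  induction n with
  | zero => simp
  | succ n ih =>
    rw [← (Fin.consEquiv fun _ => Fin d).sum_comp, Fintype.sum_prod_type]
    simp only [Fin.consEquiv_apply, Fin.prod_univ_succ, Fin.cons_zero, Fin.cons_succ,
      List.ofFn_succ, List.prod_cons, ← ih, Finset.sum_mul, Finset.mul_sum, Matrix.smul_mul,
      Matrix.mul_smul, smul_smul]
    rw [Finset.sum_comm]
    exact Finset.sum_congr rfl fun _ _ => Finset.sum_congr rfl fun _ _ => by rw [mul_comm (M 0 _)]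

/-- The `N`-periodic extension of `S`. -/
def periodic {N : ℕ} (hN : 0 < N) (S : Fin N → GL (Fin d) ℂ) (k : ℕ) : GL (Fin d) ℂ :=
  S ⟨k % N, Nat.mod_lt _ hN⟩

theorem sameState_of_mulVec_mps_eq {A : Fiducial d D} {N : ℕ} (hN : 0 < N)
    {S : Fin N → GL (Fin d) ℂ} (h : productOperator (fun k => (S k).1) *ᵥ mps A N = mps A N) :
    SameState (fun _ => slice A) (dressed (fun k => (periodic hN S k).1) A) N := by
  intro p
  induction p with
  | zero =>
    intro w hw
    obtain ⟨v, rfl⟩ := exists_ofFn_eq w hw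
    rw [blockProduct_ofFn, blockProduct_ofFn]
    have h1 := congrFun h v
    simp only [Matrix.mulVec, dotProduct, productOperator, Matrix.of_apply, mps, wordProduct] at h1
    rw [← h1]
    simp only [← smul_eq_mul, ← Matrix.trace_smul, ← Matrix.trace_sum]
    rw [sum_prod_smul_ofFn (slice A) fun k j => (S k).1 (v k) j]
    simp [dressed, periodic, Nat.mod_eq_of_lt]
  | succ p ih =>
    intro w hw
    -- The last letter sits at site `p + N`, which carries the same operator as site `p`; cyclicity
    -- of the trace moves it to the front.
    obtain ⟨v, i, rfl⟩ : ∃ v i, w = v ++ [i] := by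
      rcases List.eq_nil_or_concat w with rfl | ⟨v, i, rfl⟩
      · simp at hw; omega
      · exact ⟨v, i, by simp⟩
    have hv : v.length + 1 = N := by simpa using hw
    have h1 := ih (i :: v) (by simpa using hw)
    have hp : periodic hN S (p + 1 + v.length) = periodic hN S p := by
      simp [periodic, add_assoc, add_comm 1, hv]
    rw [blockProduct_append, blockProduct_append, Matrix.trace_mul_comm,
      Matrix.trace_mul_comm (blockProduct (dressed _ A) _ _)]
    simpa [blockProduct, dressed, hp] using h1

theorem mps_ne_zero {A : Fiducial d D} (hD : 0 < D) {N : ℕ}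
    (h : Separates (fun _ => slice A) 0 N) : mps A N ≠ 0 := by
  intro h0
  have : (1 : Matrix (Fin D) (Fin D) ℂ) = 0 := by
    refine h 1 fun w hw => ?_
    obtain ⟨v, rfl⟩ := exists_ofFn_eq w hw
    rw [blockProduct_ofFn, one_mul]
    exact congrFun h0 v
  simpa using congrArg (fun M : Matrix (Fin D) (Fin D) ℂ => M ⟨0, hD⟩ ⟨0, hD⟩) this

/-- If all local symmetries of a nonzero state have scalar factors, then they are trivial. -/
theorem localSymmetries_eq_one {N : ℕ} {ψ : (Fin N → Fin d) → ℂ} (hψ : ψ ≠ 0)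
    (h : ∀ S : Fin N → GL (Fin d) ℂ, productOperator (fun k => (S k).1) *ᵥ ψ = ψ →
      ∀ k, S k ∈ trivialOperators d) : localSymmetries ψ = {1} := by
  have hone : productOperator (fun _ : Fin N => (1 : Matrix (Fin d) (Fin d) ℂ)) = 1 := by
    ext s t
    simp only [productOperator, Matrix.of_apply, Matrix.one_apply]
    rw [Finset.prod_ite_zero]
    simp [funext_iff]
  ext T
  simp only [localSymmetries, Set.mem_ofPred_eq, Set.mem_singleton_iff]
  constructor
  · rintro ⟨S, rfl, hS⟩
    choose c hc using h S hS
    have h1 : productOperator (fun k => (S k).1) =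
        (∏ k, c k) • (1 : Matrix (Fin N → Fin d) (Fin N → Fin d) ℂ) := by
      rw [← hone]
      ext s t
      simp [productOperator, hc, Finset.prod_mul_distrib]
    rw [h1, Matrix.smul_mulVec, Matrix.one_mulVec] at hS
    obtain ⟨s, hs⟩ := Function.ne_iff.1 hψ
    have h2 := congrFun hS s
    rw [Pi.smul_apply, smul_eq_mul] at h2
    rw [h1, mul_right_cancel₀ hs (h2.trans (one_mul _).symm), one_smul]
  · rintro rfl
    refine ⟨fun _ => 1, by simp [hone], by simp⟩

/-- Local symmetries of a normal matrix product state are trivial as soon as the operators that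
preserve the states on all sites are. -/
theorem localSymmetries_mps_eq_one (hD : 1 < D) {A : Fiducial d D} {L N : ℕ}
    (hA : InjectiveAtLength A L) (hN : 2 * L + 1 ≤ N)
    (h : ∀ S : ℕ → GL (Fin d) ℂ, (∀ k, S (k + N) = S k) →
      SameState (fun _ => slice A) (dressed (fun k => (S k).1) A) N → ∀ k, S k ∈ trivialOperators d) :
    localSymmetries (mps A N) = {1} := by
  have hL := hA.pos hD
  refine localSymmetries_eq_one
    (mps_ne_zero (by omega) (separates_of_le hL hA.separates (by omega) 0)) fun S hS k => ?_
  have := h (periodic (by omega) S) (fun k => by simp [periodic])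
    (sameState_of_mulVec_mps_eq (by omega) hS) k
  simpa [periodic, Nat.mod_eq_of_lt] using this

/-- Removing a site from `N ≥ 2L + 1` leaves blocks of lengths `L` and `m ≥ L`, both injective, so
the ranks at that site are determined. -/
theorem localSymmetries_of_onlyTrivialMoebius (hD : 1 < D) {x : Fin D → ℂ}
    (hx : OnlyTrivialMoebius x) {A : Fiducial 2 D} (hA : A ∈ SLOCCClass (diagonalFiducial x))
    {L N : ℕ} (hL : InjectiveAtLength A L) (hN : 2 * L + 1 ≤ N) :
    localSymmetries (mps A N) = {1} := by
  obtain ⟨m, rfl⟩ : ∃ m, N = 1 + L + m := ⟨N - 1 - L, by omega⟩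
  have hA1 := fun q => separates_of_le (hL.pos hD) hL.separates le_rfl q
  have hA2 := fun q => separates_of_le (hL.pos hD) hL.separates (show L ≤ m by omega) q
  refine localSymmetries_mps_eq_one hD hL hN fun S _ hS k => ?_
  exact mem_trivialOperators_of_mulRank_eq (by omega) hx hA (S k) fun κ =>
    hS.mulRank_eq k hA1 (fun q => separates_dressed (hA1 q)) hA2
      (fun q => separates_dressed (hA2 q)) κ

end Chain


/-! ### Holomorphic matrix-valued functions -/

section EntryDifferentiability

variable {E : Type*} [NormedAddCommGroup E] [NormedSpace ℂ E] {n : Type*}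

/-- The entries of a matrix-valued function are holomorphic at a point. -/
def EntriesDifferentiableAt (F : E → Matrix n n ℂ) (e : E) : Prop :=
  ∀ i j, DifferentiableAt ℂ (fun e => F e i j) e

namespace EntriesDifferentiableAt

variable {F G : E → Matrix n n ℂ} {e : E}

theorem mul [Fintype n] (hF : EntriesDifferentiableAt F e) (hG : EntriesDifferentiableAt G e) :
    EntriesDifferentiableAt (fun e => F e * G e) e := by
  intro i j
  simp only [Matrix.mul_apply]
  exact DifferentiableAt.fun_sum fun k _ => (hF i k).mul (hG k j)

theorem const (M : Matrix n n ℂ) : EntriesDifferentiableAt (fun _ : E => M) e := fun _ _ =>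
  differentiableAt_const _

theorem trace [Fintype n] (hF : EntriesDifferentiableAt F e) :
    DifferentiableAt ℂ (fun e => (F e).trace) e :=
  DifferentiableAt.fun_sum fun k _ => hF k k

variable [Fintype n] [DecidableEq n]

theorem pow (hF : EntriesDifferentiableAt F e) (k : ℕ) :
    EntriesDifferentiableAt (fun e => F e ^ k) e := by
  induction k with
  | zero => simpa using const 1
  | succ k ih => simpa only [pow_succ] using ih.mul hF

theorem det (hF : EntriesDifferentiableAt F e) : DifferentiableAt ℂ (fun e => (F e).det) e := by
  simp only [Matrix.det_apply']
  exact DifferentiableAt.fun_sum fun σ _ =>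
    (differentiableAt_const _).mul (by
      have h := fun i => hF (σ i) i
      fun_prop)

theorem adjugate (hF : EntriesDifferentiableAt F e) :
    EntriesDifferentiableAt (fun e => (F e).adjugate) e := by
  intro i j
  simp only [Matrix.adjugate_apply]
  refine det fun k l => ?_
  by_cases hk : k = j
  · subst hk
    simp
  · simpa [Matrix.updateRow_ne hk] using hF k l

theorem inv (hF : EntriesDifferentiableAt F e) (h : (F e).det ≠ 0) :
    EntriesDifferentiableAt (fun e => (F e)⁻¹) e := by
  intro i j
  simp only [Matrix.inv_def, Ring.inverse_eq_inv', Matrix.smul_apply, smul_eq_mul]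
  exact (hF.det.inv h).mul (hF.adjugate i j)

end EntriesDifferentiableAt

end EntryDifferentiability

/-! ### Generic tensors are normal -/

section Normality

variable {D : ℕ}

instance isAddHaarMeasure_volume_fiducial (d D : ℕ) :
    (volume : Measure (Fiducial d D)).IsAddHaarMeasure := by
  have : (volume : Measure (Fin D → Fin D → ℂ)).IsAddHaarMeasure :=
    Measure.pi.isAddHaarMeasure fun _ => (volume : Measure (Fin D → ℂ))
  exact Measure.pi.isAddHaarMeasure fun _ => (volume : Measure (Fin D → Fin D → ℂ))

theorem entriesDifferentiableAt_slice (i : Fin 2) (A : Fiducial 2 D) :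
    EntriesDifferentiableAt (fun A : Fiducial 2 D => slice A i) A := by
  intro α β
  simp only [slice, Matrix.of_apply]
  fun_prop

theorem entriesDifferentiableAt_wordProduct {N : ℕ} (w : Fin N → Fin 2) (A : Fiducial 2 D) :
    EntriesDifferentiableAt (fun A : Fiducial 2 D => wordProduct A w) A := by
  induction N with
  | zero => simpa [wordProduct] using EntriesDifferentiableAt.const 1
  | succ N ih =>
    have : (fun A : Fiducial 2 D => wordProduct A w) =
        fun A => slice A (w 0) * wordProduct A fun k => w k.succ := by
      funext A
      simp [wordProduct]
    rw [this]
    exact (entriesDifferentiableAt_slice _ A).mul (ih _)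

/-- The contraction of `L` consecutive tensors, as a linear map. -/
noncomputable def contraction (A : Fiducial 2 D) (L : ℕ) :
    Matrix (Fin D) (Fin D) ℂ →ₗ[ℂ] ((Fin L → Fin 2) → ℂ) :=
  LinearMap.pi fun w => Matrix.traceLinearMap (Fin D) ℂ ℂ ∘ₗ LinearMap.mulRight ℂ (wordProduct A w)

theorem injectiveAtLength_iff (A : Fiducial 2 D) (L : ℕ) :
    InjectiveAtLength A L ↔ Function.Injective (contraction A L) := Iff.rfl

/-- Injectivity at a given length is a generic property as soon as one tensor has it. -/
theorem ae_injectiveAtLength {A : Fiducial 2 D} {L : ℕ} (hA : InjectiveAtLength A L) :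
    ∀ᵐ B : Fiducial 2 D, InjectiveAtLength B L := by
  -- With a left inverse `G` at `A`, the determinant of `G ∘ contraction B` is holomorphic in `B`,
  -- equals `1` at `B = A`, and forces injectivity wherever it is nonzero.
  obtain ⟨G, hG⟩ := (contraction A L).exists_leftInverse_of_injective (LinearMap.ker_eq_bot.2 hA)
  let b := Matrix.stdBasis ℂ (Fin D) (Fin D)
  have hd : Differentiable ℂ fun B : Fiducial 2 D =>
      (LinearMap.toMatrix b b (G ∘ₗ contraction B L)).det := by
    intro B
    refine EntriesDifferentiableAt.det fun i j => ?_
    simp only [LinearMap.toMatrix_apply]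
    have h1 : DifferentiableAt ℂ (fun B : Fiducial 2 D => contraction B L (b j)) B := by
      rw [differentiableAt_pi]
      exact fun w => EntriesDifferentiableAt.trace
        ((EntriesDifferentiableAt.const (b j)).mul (entriesDifferentiableAt_wordProduct w B))
    exact ((LinearMap.toContinuousLinearMap (b.coord i ∘ₗ G)).differentiableAt).comp B h1
  have := ae_ne_zero_of_differentiable volume hd A (by simp [hG])
  filter_upwards [this] with B hB
  rw [LinearMap.det_toMatrix] at hB
  rw [injectiveAtLength_iff]
  have h2 := LinearMap.ker_eq_bot.1 ((LinearMap.isUnit_iff_ker_eq_bot _).1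
    ((LinearMap.isUnit_iff_isUnit_det _).2 (isUnit_iff_ne_zero.2 hB)))
  rw [LinearMap.coe_comp] at h2
  exact h2.of_comp

/-- The tensor of the diagonal matrix with entries `1, …, D` and the matrix all of whose entries
are `1`. -/
def diagonalOnesFiducial (D : ℕ) : Fiducial 2 D :=
  ![Matrix.diagonal fun k : Fin D => ((k : ℕ) : ℂ) + 1, Matrix.of fun _ _ => 1]

/-- With `Δ` the diagonal matrix and `J` the all-ones matrix, the word `Δ^a J Δ^b J Δ^c` is `tr
(Δ^b)` times the rank-one matrix `x^a ⊗ x^c`. For `a, c < D` these matrices span everything, by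
Vandermonde. -/
theorem injectiveAtLength_diagonalOnesFiducial :
    InjectiveAtLength (diagonalOnesFiducial D) (2 * D) := by
  rw [injectiveAtLength_iff, ← LinearMap.ker_eq_bot, LinearMap.ker_eq_bot']
  intro X hX
  set x : Fin D → ℂ := fun k => ((k : ℕ) : ℂ) + 1 with hx
  have hinj : Function.Injective x := fun i j hij => by
    simpa [hx, Fin.val_inj] using hij
  have h0 : slice (diagonalOnesFiducial D) 0 = Matrix.diagonal x := rfl
  have h1 : slice (diagonalOnesFiducial D) 1 = Matrix.of fun _ _ => 1 := rfl
  have hw : ∀ a c : Fin D, ∑ β, ∑ α, x β ^ (c : ℕ) * X β α * x α ^ (a : ℕ) = 0 := by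
    intro a c
    -- Padding to total length `2 * D`; the subtraction does not truncate because `a, c ≤ D - 1`.
    let b : ℕ := 2 * D - 2 - a - c
    obtain ⟨v, hv⟩ := exists_ofFn_eq (n := 2 * D) (List.replicate (a : ℕ) (0 : Fin 2) ++
      1 :: (List.replicate b 0 ++ 1 :: List.replicate (c : ℕ) 0)) (by simp [b]; omega)
    have h2 : (X * wordProduct (diagonalOnesFiducial D) v).trace = 0 := congrFun hX v
    have h3 : wordProduct (diagonalOnesFiducial D) v =
        Matrix.diagonal x ^ (a : ℕ) * ((Matrix.of fun _ _ => 1) * (Matrix.diagonal x ^ b *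
          ((Matrix.of fun _ _ => 1) * Matrix.diagonal x ^ (c : ℕ)))) := by
      rw [← h0, ← h1]
      have := blockProduct_ofFn (fun _ => slice (diagonalOnesFiducial D)) 0 v
      rw [hv, blockProduct_const] at this
      rw [wordProduct, ← this]
      simp
    have hs : ∑ k, x k ^ b ≠ 0 := by
      have : ∑ k, x k ^ b = ((∑ k : Fin D, ((k : ℕ) + 1) ^ b : ℕ) : ℂ) := by simp [hx]
      rw [this, Nat.cast_ne_zero]
      exact (Finset.sum_pos (fun k _ => by positivity) ⟨a, Finset.mem_univ a⟩).ne'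
    have h4 : ∀ α β, wordProduct (diagonalOnesFiducial D) v α β =
        (∑ k, x k ^ b) * (x α ^ (a : ℕ) * x β ^ (c : ℕ)) := by
      intro α β
      rw [h3]
      simp only [Matrix.diagonal_pow]
      rw [Matrix.diagonal_mul, Matrix.mul_apply]
      simp only [Matrix.diagonal_mul, Matrix.of_apply, Matrix.mul_diagonal, Pi.pow_apply, one_mul,
        ← Finset.sum_mul]
      ring
    refine mul_left_cancel₀ hs ?_
    rw [mul_zero, ← h2, Finset.mul_sum]
    simp only [Matrix.trace, Matrix.diag, Matrix.mul_apply, h4, Finset.mul_sum]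
    exact Finset.sum_congr rfl fun _ _ => Finset.sum_congr rfl fun _ _ => by ring
  have hV : IsUnit (Matrix.vandermonde x) := by
    rw [Matrix.isUnit_iff_isUnit_det, isUnit_iff_ne_zero]
    exact Matrix.det_vandermonde_ne_zero_iff.2 hinj
  have hVt : IsUnit (Matrix.vandermonde x)ᵀ := by
    rw [Matrix.isUnit_iff_isUnit_det, Matrix.det_transpose, ← Matrix.isUnit_iff_isUnit_det]
    exact hV
  have h5 : (Matrix.vandermonde x)ᵀ * (X * Matrix.vandermonde x) = 0 := by
    ext c a
    rw [Matrix.zero_apply, ← hw a c]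
    simp only [Matrix.mul_apply, Matrix.transpose_apply, Matrix.vandermonde_apply, Finset.mul_sum,
      mul_assoc]
  rw [hVt.mul_right_eq_zero] at h5
  exact hV.mul_left_eq_zero.1 h5

theorem ae_isNormalTensor (D : ℕ) : ∀ᵐ A : Fiducial 2 D, IsNormalTensor A := by
  filter_upwards [ae_injectiveAtLength injectiveAtLength_diagonalOnesFiducial] with A hA
  exact ⟨2 * D, hA⟩

end Normality


/-! ### Generic matrices and permutations up to rescaling -/

section Rescaling

variable {D : ℕ}

/-- No nontrivial permutations of rows and columns can be undone by rescaling rows and columns. -/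
def OnlyTrivialRescaling (N : Matrix (Fin D) (Fin D) ℂ) : Prop :=
  ∀ τ υ : Equiv.Perm (Fin D), ∀ G H : Fin D → ℂ,
    (∀ β γ, N β γ = G β * H γ * N (τ β) (υ γ)) → τ = 1 ∧ υ = 1

variable {E : Type*} [NormedAddCommGroup E] [NormedSpace ℂ E] [FiniteDimensional ℂ E]
  [MeasurableSpace E] [BorelSpace E] (μ : Measure E) [μ.IsAddHaarMeasure]

/-- Rescaling preserves the cross ratio `N β γ * N β' γ' / (N β γ' * N β' γ)`. A row `β'` outside
`{β, τ β}` exists as `D > 2`; then the matrix of ones with a single `2` at `(τ β, υ γ)` violates the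
cleared identity. -/
theorem ae_row_permutation_trivial (hD : 2 < D) {F : E → Matrix (Fin D) (Fin D) ℂ}
    (hF : ∀ e, EntriesDifferentiableAt F e) (hs : Function.Surjective F) :
    ∀ᵐ e ∂μ, ∀ τ υ : Equiv.Perm (Fin D), ∀ G H : Fin D → ℂ,
      (∀ β γ, F e β γ = G β * H γ * F e (τ β) (υ γ)) → τ = 1 := by
  rw [ae_all_iff]
  intro τ
  rw [ae_all_iff]
  intro υ
  by_cases hτ : τ = 1
  · simp [hτ]
  obtain ⟨β, hβ⟩ : ∃ β, τ β ≠ β := by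
    by_contra! h
    exact hτ (Equiv.ext h)
  obtain ⟨β', hβ'⟩ : ∃ β', β' ∉ ({β, τ β} : Finset (Fin D)) := by
    by_contra! h
    have := (Finset.card_le_card (fun a _ => h a : Finset.univ ⊆ _)).trans Finset.card_le_two
    rw [Finset.card_univ, Fintype.card_fin] at this
    omega
  simp only [Finset.mem_insert, Finset.mem_singleton, not_or] at hβ'
  obtain ⟨γ, γ', -, hγ, -, -⟩ := exists_three_ne hD
  obtain ⟨p, hp⟩ := hs (Matrix.of fun i j => if i = τ β ∧ j = υ γ then 2 else 1)
  have hd : Differentiable ℂ fun e => F e β γ * F e β' γ' * (F e (τ β) (υ γ') * F e (τ β') (υ γ)) -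
      F e β γ' * F e β' γ * (F e (τ β) (υ γ) * F e (τ β') (υ γ')) := by
    intro e
    have := hF e
    exact (((this _ _).mul (this _ _)).mul ((this _ _).mul (this _ _))).sub
      (((this _ _).mul (this _ _)).mul ((this _ _).mul (this _ _)))
  have h1 : τ β' ≠ τ β := fun h => hβ'.1 (τ.injective h)
  have h2 : υ γ' ≠ υ γ := fun h => hγ (υ.injective h).symm
  filter_upwards [ae_ne_zero_of_differentiable μ hd p
    (by simp [hp, hβ.symm, hβ'.2, h1, h2]; norm_num)] with e he G H hGH
  refine absurd ?_ he
  rw [hGH β γ, hGH β' γ', hGH β γ', hGH β' γ]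
  ring

theorem ae_onlyTrivialRescaling (hD : 2 < D) {F : E → Matrix (Fin D) (Fin D) ℂ}
    (hF : ∀ e, EntriesDifferentiableAt F e) (hs : Function.Surjective F) :
    ∀ᵐ e ∂μ, OnlyTrivialRescaling (F e) := by
  filter_upwards [ae_row_permutation_trivial μ hD hF hs,
    ae_row_permutation_trivial μ hD (F := fun e => (F e)ᵀ) (fun e i j => hF e j i)
      (fun M => (hs Mᵀ).imp fun e h => show (F e)ᵀ = M by rw [h, Matrix.transpose_transpose])] with e h1 h2
  exact fun τ υ G H h => ⟨h1 τ υ G H h, h2 υ τ H G fun β γ => by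
    rw [Matrix.transpose_apply, Matrix.transpose_apply, h γ β, mul_comm (G γ)]⟩

end Rescaling

/-! ### Distinct eigenvalues from a Hankel determinant -/

section Eigenvalues

variable {D : ℕ}

open Polynomial in
/-- If the Hankel matrix of the traces of the powers of `Y` is invertible, then the eigenvalues
of `Y` are distinct. -/
theorem nodup_roots_charpoly {Y : Matrix (Fin D) (Fin D) ℂ}
    (h : (Matrix.of fun i j : Fin D => (Y ^ ((i : ℕ) + j)).trace).det ≠ 0) :
    Y.charpoly.roots.Nodup := by
  by_contra hn
  rw [Multiset.nodup_iff_count_le_one] at hn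
  push Not at hn
  obtain ⟨l, hl⟩ := hn
  rw [count_roots] at hl
  have hp0 : Y.charpoly ≠ 0 := Y.charpoly_monic.ne_zero
  obtain ⟨q, hq⟩ := (le_rootMultiplicity_iff hp0).1 hl
  have hmonic : (X - C l : ℂ[X]).Monic := monic_X_sub_C l
  have hn0 : (X - C l) * q ≠ 0 := by
    intro h0
    rw [Nat.succ_eq_add_one, pow_two, mul_assoc, h0, mul_zero] at hq
    exact hp0 hq
  have hdeg : ((X - C l) * q).natDegree < D := by
    have : Y.charpoly.natDegree = D := by rw [Matrix.charpoly_natDegree_eq_dim, Fintype.card_fin]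
    rw [hq, Nat.succ_eq_add_one, pow_two, mul_assoc, hmonic.natDegree_mul' hn0,
      natDegree_X_sub_C] at this
    omega
  -- A repeated root gives a characteristic polynomial `(X - l)^2 * q`. Then `(X - l) * q` is
  -- square-zero at `Y`, so its products with powers of `Y` are traceless, and its coefficients form
  -- a kernel vector of the Hankel matrix.
  have hsq : aeval Y ((X - C l) * q) ^ 2 = 0 := by
    rw [← map_pow, mul_pow]
    have : (X - C l) ^ 2 * q ^ 2 = Y.charpoly * q := by rw [hq]; ring
    rw [this, map_mul, Matrix.aeval_self_charpoly, zero_mul]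
  have htr : ∀ j : ℕ, (aeval Y ((X - C l) * q) * Y ^ j).trace = 0 := by
    intro j
    refine (Matrix.isNilpotent_trace_of_isNilpotent ⟨2, ?_⟩).eq_zero
    have hc : Commute (aeval Y ((X - C l) * q)) (Y ^ j) := by
      simpa only [map_pow, aeval_X] using
        (Commute.all ((X - C l) * q) ((X : ℂ[X]) ^ j)).map (aeval Y)
    rw [hc.mul_pow, hsq, zero_mul]
  refine h (Matrix.exists_mulVec_eq_zero_iff.1 ⟨fun k => ((X - C l) * q).coeff k, ?_, ?_⟩)
  · intro h0
    refine hn0 (Polynomial.ext fun k => ?_)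
    rcases lt_or_ge k D with hk | hk
    · exact congrFun h0 ⟨k, hk⟩
    · exact coeff_eq_zero_of_natDegree_lt (hdeg.trans_le hk)
  · funext j
    rw [Pi.zero_apply, ← htr j, aeval_eq_sum_range' hdeg, Finset.sum_range, Finset.sum_mul,
      Matrix.trace_sum]
    simp only [Matrix.mulVec, dotProduct, Matrix.of_apply, Matrix.smul_mul, Matrix.trace_smul,
      smul_eq_mul, ← pow_add, add_comm (j : ℕ)]
    exact Finset.sum_congr rfl fun _ _ => mul_comm _ _

theorem exists_diagonalization {Y : Matrix (Fin D) (Fin D) ℂ} (h : Y.charpoly.roots.Nodup) :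
    ∃ (y : Fin D → ℂ) (b : Matrix (Fin D) (Fin D) ℂ), Function.Injective y ∧ b.det ≠ 0 ∧
      Y * b = b * Matrix.diagonal y := by
  have hcard : Y.charpoly.roots.card = D := by
    rw [IsAlgClosed.card_roots_eq_natDegree, Matrix.charpoly_natDegree_eq_dim, Fintype.card_fin]
  obtain ⟨y, hy, hyr⟩ : ∃ y : Fin D → ℂ, Function.Injective y ∧ ∀ i, y i ∈ Y.charpoly.roots := by
    let s : Finset ℂ := ⟨Y.charpoly.roots, h⟩
    let e := s.equivFinOfCardEq hcard
    exact ⟨fun i => (e.symm i).1, fun i j hij => e.symm.injective (Subtype.ext hij),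
      fun i => (e.symm i).2⟩
  have hv : ∀ i, ∃ v : Fin D → ℂ, v ≠ 0 ∧ Y *ᵥ v = y i • v := by
    intro i
    have h1 := Polynomial.isRoot_of_mem_roots (hyr i)
    rw [Polynomial.IsRoot, Matrix.eval_charpoly] at h1
    obtain ⟨v, hv, hv'⟩ := Matrix.exists_mulVec_eq_zero_iff.2 h1
    refine ⟨v, hv, ?_⟩
    rw [Matrix.sub_mulVec, sub_eq_zero] at hv'
    rw [← hv', Matrix.scalar_apply, ← Matrix.smul_one_eq_diagonal, Matrix.smul_mulVec,
      Matrix.one_mulVec]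
  choose v hv0 hv using hv
  have hli : LinearIndependent ℂ v :=
    Module.End.eigenvectors_linearIndependent' Y.mulVecLin y hy v fun i =>
      Module.End.hasEigenvector_iff.2 ⟨Module.End.mem_eigenspace_iff.2 (hv i), hv0 i⟩
  refine ⟨y, Matrix.of fun i j => v j i, hy, ?_, ?_⟩
  · have h2 : IsUnit (Matrix.of v) := Matrix.linearIndependent_rows_iff_isUnit.1 hli
    rw [Matrix.isUnit_iff_isUnit_det, isUnit_iff_ne_zero, ← Matrix.det_transpose] at h2
    exact h2
  · ext i j
    rw [Matrix.mul_diagonal]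
    have := congrFun (hv j) i
    rw [Pi.smul_apply, smul_eq_mul, mul_comm] at this
    exact this

end Eigenvalues


/-! ### Normal form of a generic tensor -/

section NormalForm

variable {D : ℕ}

/-- The matrix `A 1` with the entry in row `r α` of each column `α` replaced by `1`. -/
def normalizedMatrix (r : Fin D → Fin D) (A : Fiducial 2 D) : Matrix (Fin D) (Fin D) ℂ :=
  Matrix.of fun i α => if i = r α then 1 else A 1 i α

/-- The entries of `A 1` that `normalizedMatrix` replaces. -/
def freeVector (r : Fin D → Fin D) (A : Fiducial 2 D) : Fin D → ℂ := fun α => A 1 (r α) α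

/-- The tensor with matrices `b N⁻¹ b⁻¹` and `b diag(x) N⁻¹ b⁻¹`, where `N = A 0`, and where `x` and
the normalized matrix `b` are read off from `A 1`. -/
noncomputable def normalForm (r : Fin D → Fin D) (A : Fiducial 2 D) : Fiducial 2 D :=
  ![normalizedMatrix r A * (slice A 0)⁻¹ * (normalizedMatrix r A)⁻¹,
    normalizedMatrix r A * Matrix.diagonal (freeVector r A) * (slice A 0)⁻¹ *
      (normalizedMatrix r A)⁻¹]

/-- The properties of `x` and `N` that are used of a generic tensor. -/
def GenericData (x : Fin D → ℂ) (N : Matrix (Fin D) (Fin D) ℂ) : Prop :=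
  Function.Injective x ∧ (4 < D → OnlyTrivialMoebius x) ∧ OnlyTrivialRescaling N

theorem differentiableAt_normalForm (r : Fin D → Fin D) {A : Fiducial 2 D}
    (h0 : (slice A 0).det ≠ 0) (h1 : (normalizedMatrix r A).det ≠ 0) :
    DifferentiableAt ℂ (normalForm r) A := by
  have hb : EntriesDifferentiableAt (normalizedMatrix r) A := by
    intro i α
    simp only [normalizedMatrix, Matrix.of_apply]
    split_ifs <;> fun_prop
  have hx : EntriesDifferentiableAt (fun A => Matrix.diagonal (freeVector r A)) A := by
    intro i j
    simp only [Matrix.diagonal_apply, freeVector]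
    split_ifs <;> fun_prop
  have hN := (entriesDifferentiableAt_slice 0 A).inv h0
  have e0 := (hb.mul hN).mul (hb.inv h1)
  have e1 := ((hb.mul hx).mul hN).mul (hb.inv h1)
  rw [differentiableAt_pi]
  intro i
  rw [differentiableAt_pi]
  intro j
  rw [differentiableAt_pi]
  intro k
  fin_cases i
  · exact e0 j k
  · exact e1 j k

theorem ae_genericData (hD : 2 < D) (r : Fin D → Fin D) :
    ∀ᵐ A : Fiducial 2 D, GenericData (freeVector r A) (slice A 0) := by
  have hx : Differentiable ℂ (freeVector r) := by
    unfold freeVector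
    fun_prop
  have hs : Function.Surjective (freeVector r) := fun x => ⟨fun _ _ α => x α, rfl⟩
  have hN : Function.Surjective fun A : Fiducial 2 D => slice A 0 := fun M =>
    ⟨fun _ => M, rfl⟩
  have h2 : ∀ᵐ A : Fiducial 2 D, 4 < D → OnlyTrivialMoebius (freeVector r A) := by
    by_cases h : 4 < D
    · simpa [h] using ae_onlyTrivialMoebius volume h hx hs
    · simp [h]
  filter_upwards [ae_injective volume hx hs, h2,
    ae_onlyTrivialRescaling volume hD (entriesDifferentiableAt_slice 0) hN] with A h1 h2 h3
  exact ⟨h1, h2, h3⟩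

/-- The values of `normalForm r` at the tensors without generic data form a null set. -/
theorem ae_notMem_image_normalForm (hD : 2 < D) (r : Fin D → Fin D) :
    ∀ᵐ A : Fiducial 2 D, A ∉ normalForm r '' {P | (slice P 0).det ≠ 0 ∧
      (normalizedMatrix r P).det ≠ 0 ∧ ¬ GenericData (freeVector r P) (slice P 0)} := by
  have h0 : volume {P : Fiducial 2 D | (slice P 0).det ≠ 0 ∧
      (normalizedMatrix r P).det ≠ 0 ∧ ¬ GenericData (freeVector r P) (slice P 0)} = 0 :=
    measure_mono_null (fun P hP => hP.2.2) (ae_iff.1 (ae_genericData hD r))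
  -- Differentiable maps of a space to itself preserve null sets. Normalizing one entry in each
  -- column of `b` frees `D` coordinates, exactly the room needed for `x`.
  have := addHaar_image_eq_zero_of_differentiableOn_of_addHaar_eq_zero volume (f := normalForm r)
    (fun P hP => ((differentiableAt_normalForm r hP.1 hP.2.1).restrictScalars ℝ
      ).differentiableWithinAt) h0
  rw [ae_iff]
  simp only [not_not]
  exact this

/-- Using the adjugate instead of the inverse keeps the Hankel determinant holomorphic everywhere.
At a diagonal pencil the Hankel matrix is `Vᵀ V` for the Vandermonde matrix `V`. -/
theorem ae_nodup_roots : ∀ᵐ A : Fiducial 2 D, (slice A 0).det ≠ 0 ∧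
    (slice A 1 * (slice A 0).adjugate).charpoly.roots.Nodup := by
  let x : Fin D → ℂ := fun k => ((k : ℕ) : ℂ)
  have hx : Function.Injective x := fun a b hab => Fin.ext (Nat.cast_injective hab)
  have s0 : slice (diagonalFiducial x) 0 = 1 := by simp [slice_diagonalFiducial]
  have s1 : slice (diagonalFiducial x) 1 = Matrix.diagonal x := by simp [slice_diagonalFiducial]
  have h0 := ae_ne_zero_of_differentiable volume
    (fun A : Fiducial 2 D => (entriesDifferentiableAt_slice 0 A).det) (diagonalFiducial x)
    (by simp [s0])
  have h1 := ae_ne_zero_of_differentiable volume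
    (f := fun A : Fiducial 2 D => (Matrix.of fun i j : Fin D =>
      ((slice A 1 * (slice A 0).adjugate) ^ ((i : ℕ) + j)).trace).det)
    (fun A => EntriesDifferentiableAt.det fun i j =>
      (((entriesDifferentiableAt_slice 1 A).mul
        (entriesDifferentiableAt_slice 0 A).adjugate).pow _).trace) (diagonalFiducial x) (by
    have : (Matrix.of fun i j : Fin D => ((slice (diagonalFiducial x) 1 *
        (slice (diagonalFiducial x) 0).adjugate) ^ ((i : ℕ) + j)).trace) =
        (Matrix.vandermonde x)ᵀ * Matrix.vandermonde x := by
      ext i j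
      rw [Matrix.vandermonde_transpose_mul_vandermonde]
      simp [s0, s1, Matrix.diagonal_pow, Matrix.trace_diagonal]
    rw [this, Matrix.det_mul, Matrix.det_transpose]
    exact mul_ne_zero (Matrix.det_vandermonde_ne_zero_iff.2 hx)
      (Matrix.det_vandermonde_ne_zero_iff.2 hx))
  filter_upwards [h0, h1] with A hA0 hA1
  exact ⟨hA0, nodup_roots_charpoly hA1⟩

/-- A generic tensor has the matrices `b diag(x)^i N⁻¹ b⁻¹` with generic `x` and `N`. -/
theorem ae_exists_genericData (hD : 2 < D) : ∀ᵐ A : Fiducial 2 D,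
    ∃ (x : Fin D → ℂ) (b N : Matrix (Fin D) (Fin D) ℂ), b.det ≠ 0 ∧ N.det ≠ 0 ∧
      GenericData x N ∧ slice A 0 = b * N⁻¹ * b⁻¹ ∧
      slice A 1 = b * Matrix.diagonal x * N⁻¹ * b⁻¹ := by
  filter_upwards [ae_all_iff.2 fun r => ae_notMem_image_normalForm hD r, ae_nodup_roots]
    with A hA ⟨h0, h1⟩
  obtain ⟨y, b, hy, hb, hYb⟩ := exists_diagonalization h1
  have hcol : ∀ α, ∃ i, b i α ≠ 0 := by
    intro α
    by_contra! h
    exact hb (Matrix.det_eq_zero_of_column_eq_zero α h)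
  -- The rows `r` depend on `A`, but there are finitely many choices, and `A` avoids the exceptional
  -- image for each of them.
  choose r hr using hcol
  let t : Fin D → ℂ := fun α => (b (r α) α)⁻¹
  let b' := b * Matrix.diagonal t
  have hb' : b'.det ≠ 0 := by
    rw [Matrix.det_mul, Matrix.det_diagonal]
    exact mul_ne_zero hb (Finset.prod_ne_zero_iff.2 fun α _ => inv_ne_zero (hr α))
  have hbu : IsUnit b'.det := isUnit_iff_ne_zero.2 hb'
  have h0u : IsUnit (slice A 0).det := isUnit_iff_ne_zero.2 h0
  have hYb' : slice A 1 * (slice A 0).adjugate * b' = b' * Matrix.diagonal y := by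
    rw [← mul_assoc, hYb, mul_assoc, mul_assoc, (Matrix.commute_diagonal _ _).eq]
  -- Passing from the adjugate back to the inverse divides the eigenvalues by the determinant.
  let x : Fin D → ℂ := fun α => (slice A 0).det⁻¹ * y α
  let N := b'⁻¹ * (slice A 0)⁻¹ * b'
  have hN : N.det ≠ 0 := by
    rw [Matrix.det_mul, Matrix.det_mul, Matrix.det_nonsing_inv, Matrix.det_nonsing_inv,
      Ring.inverse_eq_inv']
    exact mul_ne_zero (mul_ne_zero (inv_ne_zero hb') (inv_ne_zero h0)) hb'
  have hNinv : N⁻¹ = b'⁻¹ * slice A 0 * b' := by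
    refine Matrix.inv_eq_left_inv ?_
    simp only [N, mul_assoc]
    rw [Matrix.mul_nonsing_inv_cancel_left _ _ hbu, Matrix.mul_nonsing_inv_cancel_left _ _ h0u,
      Matrix.nonsing_inv_mul _ hbu]
  have e0 : slice A 0 = b' * N⁻¹ * b'⁻¹ := by
    rw [hNinv]
    simp only [mul_assoc]
    rw [Matrix.mul_nonsing_inv _ hbu, mul_one, Matrix.mul_nonsing_inv_cancel_left _ _ hbu]
  have hx : Matrix.diagonal x = (slice A 0).det⁻¹ • Matrix.diagonal y := by
    rw [← Matrix.diagonal_smul]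
    rfl
  have e1 : slice A 1 = b' * Matrix.diagonal x * N⁻¹ * b'⁻¹ := by
    rw [hNinv, hx, Matrix.mul_smul, ← hYb']
    simp only [mul_assoc, Matrix.smul_mul]
    rw [Matrix.mul_nonsing_inv _ hbu, mul_one, Matrix.mul_nonsing_inv_cancel_left _ _ hbu,
      Matrix.adjugate_mul, Matrix.mul_smul, mul_one, smul_smul, inv_mul_cancel₀ h0, one_smul]
  refine ⟨x, b', N, hb', hN, ?_, e0, e1⟩
  -- The preimage of `A` under `normalForm r`: the entries `x` are stored where `b'` has its
  -- normalized `1`s.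
  let P : Fiducial 2 D := ![N, fun i α => if i = r α then x α else b' i α]
  have hP0 : slice P 0 = N := rfl
  have hPx : freeVector r P = x := by
    funext α
    exact if_pos rfl
  have hPb : normalizedMatrix r P = b' := by
    ext i α
    change (if i = r α then (1 : ℂ) else if i = r α then x α else b' i α) = b' i α
    by_cases h : i = r α
    · rw [if_pos h, h]
      exact ((Matrix.mul_diagonal t b (r α) α).trans (mul_inv_cancel₀ (hr α))).symm
    · rw [if_neg h, if_neg h]
  by_contra hG
  refine hA r ⟨P, ⟨by rwa [hP0], by rwa [hPb], by rwa [hP0, hPx]⟩, ?_⟩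
  funext i
  have hs : ∀ i, slice (normalForm r P) i = slice A i := by
    intro i
    fin_cases i
    · refine Eq.trans ?_ e0.symm
      rw [← hPb, ← hP0]
      rfl
    · refine Eq.trans ?_ e1.symm
      rw [← hPb, ← hP0, ← hPx]
      rfl
  exact Matrix.of.injective (hs i)

end NormalForm


/-! ### Annihilation relations determined by the state -/

section Annihilators

variable {d D : ℕ}

/-- A product vanishes exactly when its traces against the complementary injective block do, and
these traces are coefficients of the state. -/
theorem SameState.mul_blockComb_eq_zero {A B : ℕ → Fin d → Matrix (Fin D) (Fin D) ℂ} {l m : ℕ}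
    (h : SameState A B (1 + l + m)) (hB : ∀ q, Separates B q m) (p : ℕ) (κ : Fin d → ℂ)
    (c : {w : List (Fin d) // w.length = l} →₀ ℂ)
    (hA : (∑ i, κ i • A p i) * blockComb A (p + 1) l c = 0) :
    (∑ i, κ i • B p i) * blockComb B (p + 1) l c = 0 := by
  refine eq_zero_of_forall_trace_mul fun Y => ?_
  obtain ⟨e, rfl⟩ := (hB (p + 1 + l)).surjective_blockComb Y
  have h1 : ((∑ i, κ i • A p i) * blockComb A (p + 1) l c *
      blockComb A (p + 1 + l) m e).trace = 0 := by rw [hA, zero_mul, Matrix.trace_zero]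
  simp only [Finset.sum_mul, Matrix.smul_mul, Matrix.trace_sum, Matrix.trace_smul] at h1 ⊢
  rw [← h1]
  simp only [h.trace_eq]

theorem SameState.blockComb_mul_eq_zero {A B : ℕ → Fin d → Matrix (Fin D) (Fin D) ℂ} {l m : ℕ}
    (h : SameState A B (1 + l + m)) (hB : ∀ q, Separates B q l) (p : ℕ) (κ : Fin d → ℂ)
    (e : {w : List (Fin d) // w.length = m} →₀ ℂ)
    (hA : blockComb A (p + 1 + l) m e * (∑ i, κ i • A p i) = 0) :
    blockComb B (p + 1 + l) m e * (∑ i, κ i • B p i) = 0 := by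
  refine eq_zero_of_forall_trace_mul fun Y => ?_
  obtain ⟨c, rfl⟩ := (hB (p + 1)).surjective_blockComb Y
  have h1 : (blockComb A (p + 1 + l) m e * (∑ i, κ i • A p i) *
      blockComb A (p + 1) l c).trace = 0 := by rw [hA, zero_mul, Matrix.trace_zero]
  rw [mul_assoc, Matrix.trace_mul_comm] at h1 ⊢
  simp only [Finset.sum_mul, Matrix.smul_mul, Matrix.trace_sum, Matrix.trace_smul] at h1 ⊢
  rw [← h1]
  simp only [h.trace_eq]

theorem blockComb_add_period {B : ℕ → Fin d → Matrix (Fin D) (Fin D) ℂ} {n : ℕ}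
    (hB : ∀ k, B (k + n) = B k) (p l : ℕ) : blockComb B (p + n) l = blockComb B p l := by
  have h : ∀ (w : List (Fin d)) (p : ℕ), blockProduct B (p + n) w = blockProduct B p w := by
    intro w
    induction w with
    | nil => simp [blockProduct]
    | cons i w ih =>
      intro p
      simp only [blockProduct, hB]
      rw [add_right_comm, ih]
  simp only [blockComb, h]

end Annihilators

/-! ### Coordinates in which sites are diagonal -/

section DiagonalGauge

variable {D : ℕ} (b N : GL (Fin D) ℂ)

/-- The matrix `b N Z b⁻¹` of a block of tensors `b diag N⁻¹ b⁻¹`. -/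
def gauge (Z : Matrix (Fin D) (Fin D) ℂ) : Matrix (Fin D) (Fin D) ℂ := b.1 * N.1 * Z * b⁻¹.1

/-- The matrix `b diag(f) N⁻¹ b⁻¹`. -/
def site (f : Fin D → ℂ) : Matrix (Fin D) (Fin D) ℂ := b.1 * Matrix.diagonal f * N⁻¹.1 * b⁻¹.1

theorem gauge_surjective : Function.Surjective (gauge b N) := fun W =>
  ⟨N⁻¹.1 * (b⁻¹.1 * (W * b.1)), by simp [gauge, mul_assoc]⟩

theorem site_mul_gauge (f : Fin D → ℂ) (Z : Matrix (Fin D) (Fin D) ℂ) :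
    site b N f * gauge b N Z = b.1 * (Matrix.diagonal f * Z) * b⁻¹.1 := by
  simp only [site, gauge, mul_assoc, Units.inv_mul_cancel_left]

theorem gauge_mul_site (f : Fin D → ℂ) (Z : Matrix (Fin D) (Fin D) ℂ) :
    gauge b N Z * site b N f = b.1 * N.1 * (Z * Matrix.diagonal f) * (N⁻¹.1 * b⁻¹.1) := by
  simp only [site, gauge, mul_assoc, Units.inv_mul_cancel_left]

theorem site_mul_gauge_eq_zero_iff (f : Fin D → ℂ) (Z : Matrix (Fin D) (Fin D) ℂ) :
    site b N f * gauge b N Z = 0 ↔ Matrix.diagonal f * Z = 0 := by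
  rw [site_mul_gauge, Units.mul_left_eq_zero, Units.mul_right_eq_zero]

theorem gauge_mul_site_eq_zero_iff (f : Fin D → ℂ) (Z : Matrix (Fin D) (Fin D) ℂ) :
    gauge b N Z * site b N f = 0 ↔ Z * Matrix.diagonal f = 0 := by
  rw [gauge_mul_site, ← Units.val_mul, ← Units.val_mul, Units.mul_left_eq_zero,
    Units.mul_right_eq_zero]

theorem trace_site_mul_gauge_mul_gauge (f : Fin D → ℂ) (Z Z' : Matrix (Fin D) (Fin D) ℂ) :
    (site b N f * gauge b N Z * gauge b N Z').trace =
      (Matrix.diagonal f * (Z * N.1 * Z')).trace := by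
  rw [site_mul_gauge, gauge, ← mul_assoc, Matrix.trace_mul_comm]
  simp only [mul_assoc, Units.inv_mul_cancel_left]

end DiagonalGauge

/-! ### Permutations around the ring are trivial -/

section GenericSymmetries

variable {D : ℕ}

theorem eq_smul_single {Z : Matrix (Fin D) (Fin D) ℂ} {i j : Fin D}
    (hi : ∀ k l, k ≠ i → Z k l = 0) (hj : ∀ k l, l ≠ j → Z k l = 0) :
    Z = Z i j • Matrix.single i j 1 := by
  ext k l
  rw [Matrix.smul_apply, Matrix.single_apply]
  split_ifs with h
  · rw [← h.1, ← h.2, smul_eq_mul, mul_one]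
  · rw [smul_zero]
    by_cases hk : k = i
    · exact hj k l fun hl => h ⟨hk.symm, hl.symm⟩
    · exact hi k l hk

/-- The family of tensors `site b N (f p i)`. -/
def siteChain (b N : GL (Fin D) ℂ) (f : ℕ → Fin 2 → Fin D → ℂ) (p : ℕ) (i : Fin 2) :
    Matrix (Fin D) (Fin D) ℂ :=
  site b N (f p i)

theorem sum_smul_siteChain (b N : GL (Fin D) ℂ) (f : ℕ → Fin 2 → Fin D → ℂ) (p : ℕ)
    (κ : Fin 2 → ℂ) :
    ∑ i, κ i • siteChain b N f p i = site b N (fun α => ∑ i, κ i * f p i α) := by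
  have : Matrix.diagonal (fun α => ∑ i, κ i * f p i α) =
      ∑ i, κ i • Matrix.diagonal (f p i) := by
    ext i j
    simp only [Matrix.sum_apply, Matrix.smul_apply, Matrix.diagonal_apply, smul_eq_mul]
    split_ifs <;> simp
  simp only [siteChain, site, this, Finset.mul_sum, Finset.sum_mul, Matrix.mul_smul, Matrix.smul_mul]

/-- The coefficients `1, x` of the diagonal pencil, at each site. -/
def powers (x : Fin D → ℂ) (_ : ℕ) (i : Fin 2) (α : Fin D) : ℂ := x α ^ (i : ℕ)

/-- Two families of tensors `site b N (f p i)` that generate the same states on `1 + l + m` sites,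
where the Möbius transformation of the second family at `p` permutes the eigenvalues `x` of the
first by `σ p`. -/
structure PermutedChain (b N : GL (Fin D) ℂ) (x : Fin D → ℂ) (f : ℕ → Fin 2 → Fin D → ℂ)
    (σ : ℕ → Equiv.Perm (Fin D)) (l m : ℕ) : Prop where
  injective : Function.Injective x
  ne_zero : ∀ p α, f p 0 α ≠ 0
  eq_mul : ∀ p α, f p 1 α = x (σ p α) * f p 0 α
  periodic : ∀ p, f (p + (1 + l + m)) = f p
  sameState : SameState (siteChain b N (powers x)) (siteChain b N f)
    (1 + l + m)
  separates_left : ∀ q, Separates (siteChain b N (powers x)) q l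
  separates_left' : ∀ q, Separates (siteChain b N f) q l
  separates_right : ∀ q, Separates (siteChain b N (powers x)) q m
  separates_right' : ∀ q, Separates (siteChain b N f) q m

namespace PermutedChain

variable {b N : GL (Fin D) ℂ} {x : Fin D → ℂ} {f : ℕ → Fin 2 → Fin D → ℂ}
  {σ : ℕ → Equiv.Perm (Fin D)} {l m : ℕ}

theorem swap (h : PermutedChain b N x f σ l m) : PermutedChain b N x f σ m l where
  injective := h.injective
  ne_zero := h.ne_zero
  eq_mul := h.eq_mul
  periodic := by simpa only [add_right_comm] using h.periodic
  sameState := by simpa only [add_right_comm] using h.sameState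
  separates_left := h.separates_right
  separates_left' := h.separates_right'
  separates_right := h.separates_left
  separates_right' := h.separates_left'

/-- The combination `(-x α, 1)` of the first pencil vanishes only at `α`, hence kills a matrix unit
without its row there only if that row is `α`. Its counterpart in the second family vanishes only at
`σ⁻¹ α`, which confines `Z` to that row. -/
theorem row_eq_zero (h : PermutedChain b N x f σ l m) (p : ℕ) {α β : Fin D}
    {c : {w : List (Fin 2) // w.length = l} →₀ ℂ} {Z : Matrix (Fin D) (Fin D) ℂ}
    (hA : blockComb (siteChain b N (powers x)) (p + 1) l c =
      gauge b N (Matrix.single α β 1))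
    (hB : blockComb (siteChain b N f) (p + 1) l c = gauge b N Z)
    (k j : Fin D) (hk : k ≠ (σ p).symm α) : Z k j = 0 := by
  have h1 := h.sameState.mul_blockComb_eq_zero h.separates_right' p ![-x α, 1] c
  simp only [sum_smul_siteChain, hA, hB, site_mul_gauge_eq_zero_iff] at h1
  have h2 := congrFun (congrFun (h1 (by
    ext i j
    rw [Matrix.diagonal_mul, Matrix.single_apply]
    split_ifs with hij
    · simp [hij.1, powers]
    · simp)) k) j
  rw [Matrix.diagonal_mul, Matrix.zero_apply] at h2
  refine (mul_eq_zero.1 h2).resolve_left ?_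
  have h3 : ∑ i, ![-x α, 1] i * f p i k = (x (σ p k) - x α) * f p 0 k := by
    simp [Fin.sum_univ_two, h.eq_mul]
    ring
  rw [h3]
  refine mul_ne_zero (sub_ne_zero.2 (h.injective.ne fun hs => hk ?_)) (h.ne_zero p k)
  rw [← hs, Equiv.symm_apply_apply]

theorem column_eq_zero (h : PermutedChain b N x f σ l m) (p : ℕ) {α β : Fin D}
    {e : {w : List (Fin 2) // w.length = m} →₀ ℂ} {Z : Matrix (Fin D) (Fin D) ℂ}
    (hA : blockComb (siteChain b N (powers x)) (p + 1 + l) m e =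
      gauge b N (Matrix.single α β 1))
    (hB : blockComb (siteChain b N f) (p + 1 + l) m e = gauge b N Z)
    (j k : Fin D) (hk : k ≠ (σ p).symm β) : Z j k = 0 := by
  have h1 := h.sameState.blockComb_mul_eq_zero h.separates_left' p ![-x β, 1] e
  simp only [sum_smul_siteChain, hA, hB, gauge_mul_site_eq_zero_iff] at h1
  have h2 := congrFun (congrFun (h1 (by
    ext i j
    rw [Matrix.mul_diagonal, Matrix.single_apply]
    split_ifs with hij
    · simp [hij.2, powers]
    · simp)) j) k
  rw [Matrix.mul_diagonal, Matrix.zero_apply] at h2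
  refine (mul_eq_zero.1 h2).resolve_right ?_
  have h3 : ∑ i, ![-x β, 1] i * f p i k = (x (σ p k) - x β) * f p 0 k := by
    simp [Fin.sum_univ_two, h.eq_mul]
    ring
  rw [h3]
  refine mul_ne_zero (sub_ne_zero.2 (h.injective.ne fun hs => hk ?_)) (h.ne_zero p k)
  rw [← hs, Equiv.symm_apply_apply]

/-- A block after site `p` and before site `p + 1 + l`, at which the permutations are known. -/
theorem exists_blockComb_left (h : PermutedChain b N x f σ l m) (p : ℕ) (α β : Fin D) :
    ∃ (c : {w : List (Fin 2) // w.length = l} →₀ ℂ) (g : ℂ),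
      blockComb (siteChain b N (powers x)) (p + 1) l c =
        gauge b N (Matrix.single α β 1) ∧
      blockComb (siteChain b N f) (p + 1) l c =
        gauge b N (g • Matrix.single ((σ p).symm α) ((σ (p + 1 + l)).symm β) 1) := by
  obtain ⟨c, hc⟩ := (h.separates_left (p + 1)).surjective_blockComb
    (gauge b N (Matrix.single α β 1))
  obtain ⟨Z, hZ⟩ := gauge_surjective b N (blockComb (siteChain b N f) (p + 1) l c)
  refine ⟨c, Z ((σ p).symm α) ((σ (p + 1 + l)).symm β), hc, ?_⟩
  rw [← hZ, ← eq_smul_single]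
  · exact fun k j => h.row_eq_zero p hc hZ.symm k j
  -- Seen from site `p + 1 + l` with the block lengths exchanged, the same block comes last on the
  -- ring, one period later.
  · have hp : p + 1 + l + 1 + m = p + 1 + (1 + l + m) := by omega
    refine h.swap.column_eq_zero (p + 1 + l) (α := α) (e := c) ?_ ?_
    · rw [hp, blockComb_add_period (fun _ => rfl), hc]
    · rw [hp, blockComb_add_period (fun k => by unfold siteChain; rw [h.periodic]), hZ]

theorem exists_blockComb_right (h : PermutedChain b N x f σ l m) (p : ℕ) (γ α : Fin D) :
    ∃ (e : {w : List (Fin 2) // w.length = m} →₀ ℂ) (g : ℂ),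
      blockComb (siteChain b N (powers x)) (p + 1 + l) m e =
        gauge b N (Matrix.single γ α 1) ∧
      blockComb (siteChain b N f) (p + 1 + l) m e =
        gauge b N (g • Matrix.single ((σ (p + l)).symm γ) ((σ p).symm α) 1) := by
  obtain ⟨e, he⟩ := (h.separates_right (p + 1 + l)).surjective_blockComb
    (gauge b N (Matrix.single γ α 1))
  obtain ⟨Z, hZ⟩ := gauge_surjective b N (blockComb (siteChain b N f) (p + 1 + l) m e)
  refine ⟨e, Z ((σ (p + l)).symm γ) ((σ p).symm α), he, ?_⟩
  rw [← hZ, ← eq_smul_single]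
  · refine h.swap.row_eq_zero (p + l) (β := α) (c := e) ?_ ?_
    · rw [add_right_comm, he]
    · rw [add_right_comm, hZ]
  · exact fun j k => h.column_eq_zero p he hZ.symm j k

/-- Closing the ring with the units `(α, β)` and `(γ, α)` reads off `N β γ` from the first family,
and a multiple of its permuted entry from the second. The multiple factors into a part depending on
`β` and one depending on `γ`. -/
theorem perm_eq_one (h : PermutedChain b N x f σ l m) (hN : OnlyTrivialRescaling N.1) (hD : 0 < D)
    (p : ℕ) : σ (p + 1 + l) = 1 := by
  let α : Fin D := ⟨0, hD⟩
  choose c g hcA hcB using h.exists_blockComb_left p α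
  choose e k heA heB using fun γ => h.exists_blockComb_right p γ α
  have h1 := (hN (σ (p + 1 + l)).symm (σ (p + l)).symm
    (fun β => f p 0 ((σ p).symm α) * g β) k fun β γ => by
      have := h.sameState.trace_eq p 0 (c β) (e γ)
      rw [hcA, hcB, heA, heB, siteChain, siteChain, trace_site_mul_gauge_mul_gauge,
        trace_site_mul_gauge_mul_gauge] at this
      have key : ∀ (u : Fin D → ℂ) (i j k l : Fin D), (Matrix.diagonal u *
          (Matrix.single i j (1 : ℂ) * N.1 * Matrix.single k l (1 : ℂ))).trace =
          if i = l then u i * N.1 j k else 0 := by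
        intro u i j k l
        rw [Matrix.single_mul_mul_single, Matrix.trace]
        simp only [Matrix.diag, Matrix.diagonal_mul, Matrix.single_apply, one_mul, mul_one]
        by_cases hil : i = l
        · subst hil
          simp
        · rw [if_neg hil]
          exact Finset.sum_eq_zero fun s _ => by
            rw [if_neg fun hs => hil (hs.1.trans hs.2.symm), mul_zero]
      simp only [Matrix.smul_mul, Matrix.mul_smul, Matrix.trace_smul, key, if_true] at this
      simp only [powers, Fin.val_zero, pow_zero, one_mul, smul_eq_mul] at this
      rw [this]
      ring).1
  exact inv_eq_one.1 h1

end PermutedChain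

end GenericSymmetries


/-! ### Generic states have no local symmetries -/

section Main

variable {D : ℕ}

theorem eq_fiducialAct_of_slice {x : Fin D → ℂ} {b N : GL (Fin D) ℂ} {A : Fiducial 2 D}
    (hA : ∀ i, slice A i = site b N fun α => x α ^ (i : ℕ)) :
    A = fiducialAct 1 b.1 (transposeGL (N⁻¹ * b⁻¹)).1 (diagonalFiducial x) := by
  funext i
  have : slice A i =
      slice (fiducialAct 1 b.1 (transposeGL (N⁻¹ * b⁻¹)).1 (diagonalFiducial x)) i := by
    have hT : (transposeGL (N⁻¹ * b⁻¹)).1ᵀ = N⁻¹.1 * b⁻¹.1 := Matrix.transpose_transpose _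
    rw [hA, slice_fiducialAct, hT]
    simp [Matrix.one_apply, slice_diagonalFiducial, site, mul_assoc]
  exact Matrix.of.injective this

/-- Generic diagonal pencils generate states without local symmetries. -/
theorem localSymmetries_of_genericData (hD : 2 < D) {x : Fin D → ℂ} {b N : GL (Fin D) ℂ}
    (hx : Function.Injective x) (hN : OnlyTrivialRescaling N.1) {A : Fiducial 2 D}
    (hA : ∀ i, slice A i = site b N fun α => x α ^ (i : ℕ)) {L n : ℕ}
    (hL : InjectiveAtLength A L) (hn : 2 * L + 1 ≤ n) : localSymmetries (mps A n) = {1} := by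
  obtain ⟨m, rfl⟩ : ∃ m, n = 1 + L + m := ⟨n - 1 - L, by omega⟩
  have hA1 := fun q => separates_of_le (hL.pos (by omega)) hL.separates le_rfl q
  have hA2 := fun q => separates_of_le (hL.pos (by omega)) hL.separates (show L ≤ m by omega) q
  refine localSymmetries_mps_eq_one (by omega) hL hn fun S hper hS k => ?_
  have hact : A = fiducialAct (1 : GL (Fin 2) ℂ).1 b.1 (transposeGL (N⁻¹ * b⁻¹)).1
    (diagonalFiducial x) := eq_fiducialAct_of_slice hA
  choose σ hσ using fun p => exists_perm_of_pencil_mulRank_eq (by omega) 1 (S p) b _ x hact fun κ =>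
    hS.mulRank_eq p hA1 (fun q => separates_dressed (hA1 q)) hA2
      (fun q => separates_dressed (hA2 q)) κ
  simp only [inv_one, one_mul, mul_one] at hσ
  let f : ℕ → Fin 2 → Fin D → ℂ := fun p i α => (S p).1 i 0 + (S p).1 i 1 * x α
  have e1 : (fun _ => slice A) = siteChain b N (powers x) := by
    funext p i
    exact hA i
  have e2 : dressed (fun k => (S k).1) A = siteChain b N f := by
    funext p i
    have h1 := sum_smul_siteChain b N (powers x) p ((S p).1 i)
    rw [← e1] at h1
    simpa [dressed, siteChain, f, powers, Fin.sum_univ_two] using h1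
  have hchain : PermutedChain b N x f σ L m := by
    refine ⟨hx, fun p α => (hσ p α).1, fun p α => (hσ p α).2, fun p => ?_, ?_, ?_, ?_, ?_, ?_⟩
    · simp only [f, hper]
    · rw [← e1, ← e2]
      exact hS
    · rw [← e1]
      exact hA1
    · rw [← e2]
      exact fun q => separates_dressed (hA1 q)
    · rw [← e1]
      exact hA2
    · rw [← e2]
      exact fun q => separates_dressed (hA2 q)
  -- The start `k + m` makes the controlled site `k + m + 1 + L` one full period after `k`.
  have hone := hchain.perm_eq_one hN (by omega) (k + m)
  have hk : k + m + 1 + L = k + (1 + L + m) := by omega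
  obtain ⟨g, h0, h1, h2, h3⟩ := exists_flip (S k)
  refine mem_trivialOperators_of_flip h0 h1 h2 h3 (mem_trivialOperators_of_fixes hD hx fun i => ?_)
  have h4 := (hσ (k + m + 1 + L) i).2
  rw [hone, hk, hper, Equiv.Perm.one_apply] at h4
  rw [h0, h1, h2, h3]
  linear_combination h4

/-- A generic tensor is in the class of a generic diagonal pencil, and the states that it generates
have no local symmetries. -/
theorem ae_normalForm_and_localSymmetries (hD : 2 < D) : ∀ᵐ A : Fiducial 2 D,
    (∃ (x : Fin D → ℂ) (b c : GL (Fin D) ℂ), Function.Injective x ∧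
      (4 < D → OnlyTrivialMoebius x) ∧ A = fiducialAct 1 b.1 c.1 (diagonalFiducial x)) ∧
    ∀ L n, InjectiveAtLength A L → 2 * L + 1 ≤ n → localSymmetries (mps A n) = {1} := by
  filter_upwards [ae_exists_genericData hD] with A ⟨x, b, N, hb, hN, ⟨hx, hM, hR⟩, h0, h1⟩
  let b' := Matrix.GeneralLinearGroup.mkOfDetNeZero b hb
  let N' := Matrix.GeneralLinearGroup.mkOfDetNeZero N hN
  have hA : ∀ i, slice A i = site b' N' fun α => x α ^ (i : ℕ) := by
    have hb' : b'⁻¹.1 = b⁻¹ := Matrix.coe_units_inv b'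
    have hN' : N'⁻¹.1 = N⁻¹ := Matrix.coe_units_inv N'
    intro i
    rw [site, hb', hN', show b'.1 = b from rfl]
    fin_cases i
    · simpa using h0
    · simpa using h1
  exact ⟨⟨x, b', _, hx, hM, eq_fiducialAct_of_slice hA⟩, fun L n hL hn =>
    localSymmetries_of_genericData hD hx hR hA hL hn⟩

end Main

end TIMPS

theorem mainTheorem6 (D : ℕ) (hD : 3 < D) :
    -- generic diagonal pencils, and generic fiducial states, have distinct eigenvalues without
    -- nontrivial Möbius permutations
    (4 < D → ∀ᵐ x : Fin D → ℂ, TIMPS.OnlyTrivialMoebius x) ∧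
    (∀ᵐ A : TIMPS.Fiducial 2 D, ∃ (x : Fin D → ℂ) (b c : GL (Fin D) ℂ),
      Function.Injective x ∧ (4 < D → TIMPS.OnlyTrivialMoebius x) ∧
      A = TIMPS.fiducialAct 1 b.1 c.1 (TIMPS.diagonalFiducial x)) ∧
    -- in the SLOCC class of such a pencil, the fiducial states have only the trivial qubit symmetry
    -- and the normal matrix product states have only the trivial local symmetry
    (∀ x : Fin D → ℂ, TIMPS.OnlyTrivialMoebius x →
      ∀ A ∈ TIMPS.SLOCCClass (TIMPS.diagonalFiducial x),
        TIMPS.qubitSymmetries A = TIMPS.trivialOperators 2 ∧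
        ∀ L N : ℕ, TIMPS.InjectiveAtLength A L → 2 * L + 1 ≤ N →
          TIMPS.localSymmetries (TIMPS.mps A N) = {1}) ∧
    -- generic tensors are normal, and nontrivial local symmetries occur on a null set only
    (∀ᵐ A : TIMPS.Fiducial 2 D, TIMPS.IsNormalTensor A) ∧
    volume {A : TIMPS.Fiducial 2 D | ∃ L N : ℕ, TIMPS.InjectiveAtLength A L ∧ 2 * L + 1 ≤ N ∧
      TIMPS.localSymmetries (TIMPS.mps A N) ≠ {1}} = 0 := by
  have hgen := TIMPS.ae_normalForm_and_localSymmetries (D := D) (by omega)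
  refine ⟨fun h => TIMPS.ae_onlyTrivialMoebius volume h differentiable_id Function.surjective_id,
    hgen.mono fun A hA => hA.1, fun x hx A hA => ⟨TIMPS.qubitSymmetries_eq (by omega) hx hA,
      fun L N hL hN => TIMPS.localSymmetries_of_onlyTrivialMoebius (by omega) hx hA hL hN⟩,
    TIMPS.ae_isNormalTensor D, ?_⟩
  refine measure_mono_null ?_ (ae_iff.1 hgen)
  rintro A ⟨L, N, hL, hN, hne⟩ hA
  exact hne (hA.2 L N hL hN)
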